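/- Let $R$ be a commutative Noetherian local ring with maximal ideal $\mathfrak m$, let $I,J$ be ideals of $R$ such that $I+J$ is $\mathfrak m$-primary, and let $M$ be a finitely generated $R$-module. For an $R$-module $N$ put $$\Gamma_{I,J}(N)=\{x\in N \mid I^n x\subseteq Jx \text{ for some integer } n\ge 0\},$$ which is a submodule of $N$; this defines a left exact additive functor $\Gamma_{I,J}$ on $R$-modules (acting on homomorphisms by restriction), and $H^i_{I,J}$ denotes its $i$-th right derived functor. Then $$\sup\{\, i\ge 0 \mid H^i_{I,J}(M)\neq 0 \,\}=\dim M/JM,$$ where $\dim$ is the Krull dimension of the support of a module. Here, for $M=0$, both the supremum of the empty set and the dimension of the zero module are taken to be $-\infty$; for $M\ne 0$ the equality says that $\dim M/JM$ is the largest $i$ with $H^i_{I,J}(M)\neq 0$. -/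

import Mathlib

open CategoryTheory

universe u

namespace PairLocalCohomology

section Torsion

variable {R : Type u} [CommRing R] (I J : Ideal R)

/-- The condition `I ^ n • x ⊆ J • x` on an element `x` of a module, where
`I ^ n • x = {a • x | a ∈ I ^ n}` and `J • x = {b • x | b ∈ J}`. -/
def PowSmulSubset {M : Type u} [AddCommGroup M] [Module R M] (n : ℕ) (x : M) : Prop :=
  ∀ a ∈ I ^ n, ∃ b ∈ J, a • x = b • x

variable {I J}

/-- The condition says that `I ^ n ⊆ Ann x + J`. -/
theorem powSmulSubset_iff {M : Type u} [AddCommGroup M] [Module R M] (n : ℕ) (x : M) :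
    PowSmulSubset I J n x ↔ I ^ n ≤ Ideal.torsionOf R M x ⊔ J := by
  constructor
  · intro h a ha
    obtain ⟨b, hb, hab⟩ := h a ha
    refine Submodule.mem_sup.2 ⟨a - b, ?_, b, hb, by ring⟩
    simp [Ideal.mem_torsionOf_iff, sub_smul, hab]
  · intro h a ha
    obtain ⟨c, hc, b, hb, hcb⟩ := Submodule.mem_sup.1 (h ha)
    refine ⟨b, hb, ?_⟩
    rw [← hcb, add_smul, (Ideal.mem_torsionOf_iff x c).1 hc, zero_add]

theorem PowSmulSubset.mono {M : Type u} [AddCommGroup M] [Module R M] {n m : ℕ} {x : M}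
    (h : PowSmulSubset I J n x) (hnm : n ≤ m) : PowSmulSubset I J m x :=
  fun a ha => h a (Ideal.pow_le_pow_right hnm ha)

theorem PowSmulSubset.add {M : Type u} [AddCommGroup M] [Module R M] {n m : ℕ} {x y : M}
    (hx : PowSmulSubset I J n x) (hy : PowSmulSubset I J m y) :
    PowSmulSubset I J (n + m) (x + y) := by
  rw [powSmulSubset_iff] at hx hy ⊢
  rw [pow_add]
  refine (Ideal.mul_mono hx hy).trans (Ideal.mul_le.2 fun r hr s hs => ?_)
  obtain ⟨c, hc, b, hb, rfl⟩ := Submodule.mem_sup.1 hr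
  obtain ⟨c', hc', b', hb', rfl⟩ := Submodule.mem_sup.1 hs
  have hcx : c • x = 0 := (Ideal.mem_torsionOf_iff x c).1 hc
  have hcy : c' • y = 0 := (Ideal.mem_torsionOf_iff y c').1 hc'
  refine Submodule.mem_sup.2 ⟨c * c', ?_, c * b' + b * (c' + b'), ?_, by ring⟩
  · rw [Ideal.mem_torsionOf_iff, smul_add, mul_smul c c' y, hcy, mul_comm c c', mul_smul, hcx]
    simp
  · exact J.add_mem (J.mul_mem_left _ hb') (J.mul_mem_right _ hb)

theorem PowSmulSubset.map {M N : Type u} [AddCommGroup M] [Module R M]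
    [AddCommGroup N] [Module R N] (f : M →ₗ[R] N) {n : ℕ} {x : M}
    (hx : PowSmulSubset I J n x) : PowSmulSubset I J n (f x) := by
  intro a ha
  obtain ⟨b, hb, hab⟩ := hx a ha
  exact ⟨b, hb, by rw [← map_smul, hab, map_smul]⟩

variable (I J)

/-- The `(I, J)`-torsion part `Γ_{I,J}(M)` of a module `M`: the elements `x` with
`I ^ n • x ⊆ J • x` for some `n` (equivalently, for all large `n`). -/
def torsionPart (M : Type u) [AddCommGroup M] [Module R M] : Submodule R M where
  carrier := {x | ∃ n : ℕ, PowSmulSubset I J n x}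
  zero_mem' := ⟨0, fun _ _ => ⟨0, J.zero_mem, by simp⟩⟩
  add_mem' := fun ⟨n, hn⟩ ⟨m, hm⟩ => ⟨n + m, hn.add hm⟩
  smul_mem' := fun c _ ⟨n, hn⟩ => ⟨n, hn.map (LinearMap.lsmul R _ c)⟩

/-- The `(I, J)`-torsion functor `Γ_{I,J}` on the category of `R`-modules; on morphisms it is
restriction to the torsion parts. -/
def torsionFunctor : ModuleCat.{u} R ⥤ ModuleCat.{u} R where
  obj M := ModuleCat.of R (torsionPart I J M)
  map f := ModuleCat.ofHom (f.hom.restrict fun _ ⟨n, hn⟩ => ⟨n, hn.map f.hom⟩)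

instance : (torsionFunctor I J).Additive where

/-- The `i`-th local cohomology functor `H^i_{I,J}` with respect to the pair `(I, J)`: the
`i`-th right derived functor of `Γ_{I,J}`. -/
noncomputable def localCohomologyPair (i : ℕ) : ModuleCat.{u} R ⥤ ModuleCat.{u} R :=
  (torsionFunctor I J).rightDerived i

end Torsion

end PairLocalCohomology

/-! Put r = dim M/JM. Vanishing above r: M has an injective resolution by Ann M-power torsion
modules, and on such modules Γ_{I,J} depends on I only up to radical modulo Ann M + J. Since Supp
M/JM = Supp M ∩ V(J) and I + J has radical 𝔪, the ideal I may be replaced there by r parameters for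
M/JM. An ideal generated by r elements has no cohomology above degree r: adjoining a generator costs
one degree (`exists_boundary_cons`), because Γ_{I,J} preserves injectives and injectives are
divisible up to torsion.

Nonvanishing at r: the cokernel of H^r(M) → H^r(M/JM) embeds in H^{r+1}(JM), which is zero by the
first half, since the support of JM/J(JM) lies in that of M/JM. So it suffices to treat M/JM. On
J-power torsion modules Γ_{I,J} is Γ_𝔪, and what remains is Grothendieck nonvanishing. For r = 0 the
torsion part is the whole module. For r > 0 the stronger statement that H^r is not finitely
generated is proved by induction on the dimension (`not_finite_localCohomologyPair`), dividing by a
regular element x. The induction needs H^{r-1}(N)/xH^{r-1}(N) finitely generated; as H^{r-1}(N) is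
Artinian (`isArtinian_localCohomologyPair`), this holds for x outside finitely many nonmaximal
primes (`exists_finset_fg_sup_range`). -/

namespace PairLocalCohomology

/-! ### Torsion parts and injective modules -/

section TorsionPart

variable {R : Type u} [CommRing R] [IsNoetherianRing R] {I I' J : Ideal R}
  {M : Type u} [AddCommGroup M] [Module R M]

/-- As I is finitely generated, containment in a radical is containment of some power. This form,
free of exponents, is the one used below. -/
theorem mem_torsionPart_iff {x : M} :
    x ∈ torsionPart I J M ↔ I ≤ (Ideal.torsionOf R M x ⊔ J).radical := by
  constructor
  · rintro ⟨n, hn⟩ a ha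
    exact ⟨n, (powSmulSubset_iff n x).1 hn (Ideal.pow_mem_pow ha n)⟩
  · intro h
    obtain ⟨n, hn⟩ := Ideal.exists_pow_le_of_le_radical_of_fg h (IsNoetherian.noetherian I)
    exact ⟨n, (powSmulSubset_iff n x).2 hn⟩

theorem torsionPart_sup : torsionPart (I ⊔ I') J M = torsionPart I J M ⊓ torsionPart I' J M := by
  ext x
  simp only [Submodule.mem_inf, mem_torsionPart_iff, sup_le_iff]

/-- On `A`-power torsion modules, `Γ_{I,J}` only depends on `I` up to radical modulo `A + J`. -/
theorem torsionPart_le_of_le_radical {A : Ideal R} (h : I' ≤ (I ⊔ (A ⊔ J)).radical)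
    (hA : ∀ x : M, A ≤ (Ideal.torsionOf R M x).radical) :
    torsionPart I J M ≤ torsionPart I' J M := by
  intro x hx
  rw [mem_torsionPart_iff] at hx ⊢
  refine h.trans (Ideal.radical_le_radical_iff.2 (sup_le hx (sup_le ?_ ?_)))
  · exact (hA x).trans (Ideal.radical_mono le_sup_left)
  · exact le_sup_right.trans Ideal.le_radical

theorem le_radical_mul_sup {R : Type u} [CommRing R] {I J a b : Ideal R} (ha : I ≤ (a ⊔ J).radical)
    (hb : I ≤ (b ⊔ J).radical) : I ≤ (a * b ⊔ J).radical := by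
  refine (le_inf ha hb).trans ?_
  rw [← Ideal.radical_mul]
  refine Ideal.radical_mono ?_
  rw [Ideal.sup_mul]
  refine sup_le ?_ ((Ideal.mul_le_left).trans le_sup_right)
  rw [Ideal.mul_sup]
  exact sup_le_sup le_rfl Ideal.mul_le_right

/-- A finitely generated submodule of `Γ_{I,J}(M)` is killed by a single ideal. -/
theorem exists_ideal_smul_eq_zero {L : Submodule R M} (hL : L.FG) (hLM : L ≤ torsionPart I J M) :
    ∃ a : Ideal R, I ≤ (a ⊔ J).radical ∧ ∀ r ∈ a, ∀ x ∈ L, r • x = 0 := by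
  induction L, hL using Submodule.fg_induction with
  | singleton x =>
    refine ⟨Ideal.torsionOf R M x, mem_torsionPart_iff.1
      (hLM (Submodule.mem_span_singleton_self x)),
      fun r hr y hy => ?_⟩
    obtain ⟨c, rfl⟩ := Submodule.mem_span_singleton.1 hy
    have hrx : r • x = 0 := (Ideal.mem_torsionOf_iff x r).1 hr
    rw [smul_comm r c x, hrx, smul_zero]
  | sup L₁ L₂ _ _ h₁ h₂ =>
    obtain ⟨a, ha, ha'⟩ := h₁ (le_sup_left.trans hLM)
    obtain ⟨b, hb, hb'⟩ := h₂ (le_sup_right.trans hLM)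
    refine ⟨a * b, le_radical_mul_sup ha hb, fun r hr x hx => ?_⟩
    obtain ⟨y, hy, z, hz, rfl⟩ := Submodule.mem_sup.1 hx
    rw [smul_add, ha' r (Ideal.mul_le_left hr) y hy, hb' r (Ideal.mul_le_right hr) z hz, add_zero]

variable (I J) in
/-- Over a Noetherian ring, `Γ_{I,J}` preserves injective modules. -/
theorem injective_torsionPart (E : Type u) [AddCommGroup E] [Module R E] [Module.Injective R E] :
    Module.Injective R (torsionPart I J E) := by
  refine Module.Baer.injective fun K f => ?_
  have hE : Module.Baer R E := Module.Baer.of_injective ‹_›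
  let f' : K →ₗ[R] E := (torsionPart I J E).subtype ∘ₗ f
  obtain ⟨a, ha, haf⟩ := exists_ideal_smul_eq_zero (I := I) (J := J) (L := LinearMap.range f')
    (by rw [LinearMap.range_eq_map]; exact (Module.Finite.fg_top).map _)
    (by rintro _ ⟨k, rfl⟩; exact (f k).2)
  -- Artin–Rees: a^{k+1} ∩ K ⊆ aK, and `f'` vanishes on aK.
  obtain ⟨k, hk⟩ := Ideal.exists_pow_inf_eq_pow_smul a (K : Submodule R R)
  have hpow : ∀ (y : R) (hy : y ∈ K), y ∈ a ^ (k + 1) → f' ⟨y, hy⟩ = 0 := by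
    intro y hy hya
    have h1 : y ∈ a ^ (k + 1) • (⊤ : Submodule R R) ⊓ K :=
      ⟨by simpa using hya, hy⟩
    rw [hk (k + 1) (by omega)] at h1
    have h2 : y ∈ a • (K : Submodule R R) := by
      simp only [add_tsub_cancel_left, pow_one] at h1
      exact Submodule.smul_mono le_rfl inf_le_right h1
    have h3 : a • (K : Submodule R R) ≤ (LinearMap.ker f').map K.subtype := by
      rw [Submodule.smul_le]
      intro r hr n hn
      exact ⟨r • ⟨n, hn⟩, (map_smul f' r _).trans (haf r hr _ ⟨⟨n, hn⟩, rfl⟩), rfl⟩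
    obtain ⟨w, hw, rfl⟩ := h3 h2
    exact hw
  let p : R →ₗ.[R] E := ⟨K, f'⟩
  -- Gluing `f'` with zero on a^{k+1} before extending to R forces the value at 1 to be killed by
  -- a^{k+1}, hence to be torsion.
  let q : R →ₗ.[R] E := ⟨a ^ (k + 1), 0⟩
  have hpq : ∀ (x : p.domain) (y : q.domain), (x : R) = y → p x = q y := by
    intro x y hxy
    exact hpow x x.2 (hxy ▸ y.2)
  obtain ⟨g, hg⟩ := hE _ (p.sup q hpq).toFun
  have hgK : ∀ x (hx : x ∈ K), x • g 1 = f' ⟨x, hx⟩ := by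
    intro x hx
    rw [← map_smul, smul_eq_mul, mul_one, hg x (show x ∈ K ⊔ a ^ (k + 1) from
      Submodule.mem_sup_left hx)]
    exact ((LinearPMap.left_le_sup p q hpq).2 (x := ⟨x, hx⟩) rfl).symm
  have hga : ∀ x ∈ a ^ (k + 1), x • g 1 = 0 := by
    intro x hx
    rw [← map_smul, smul_eq_mul, mul_one, hg x (show x ∈ K ⊔ a ^ (k + 1) from
      Submodule.mem_sup_right hx)]
    exact ((LinearPMap.right_le_sup p q hpq).2 (x := ⟨x, hx⟩) rfl).symm
  have hmem : g 1 ∈ torsionPart I J E := by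
    rw [mem_torsionPart_iff]
    have : a ^ (k + 1) ≤ Ideal.torsionOf R E (g 1) := fun x hx =>
      (Ideal.mem_torsionOf_iff _ _).2 (hga x hx)
    refine ha.trans (Ideal.radical_le_radical_iff.2 (sup_le ?_ ?_))
    · refine Ideal.le_radical.trans ?_
      rw [← Ideal.radical_pow a (Nat.succ_ne_zero k)]
      exact Ideal.radical_mono (this.trans le_sup_left)
    · exact le_sup_right.trans Ideal.le_radical
  refine ⟨LinearMap.toSpanSingleton R _ ⟨g 1, hmem⟩, fun x hx => Subtype.ext ?_⟩
  exact hgK x hx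

/-- An injective module over a Noetherian ring is divisible up to torsion. -/
theorem exists_pow_succ_smul_eq (E : Type u) [AddCommGroup E] [Module R E] [Module.Injective R E]
    (s : R) (z : E) : ∃ (k : ℕ) (z' : E), s ^ (k + 1) • z' = s ^ k • z := by
  obtain ⟨k, hk⟩ : ∃ k : ℕ, ∀ r : R, s ^ (k + 1) * r = 0 → s ^ k * r = 0 := by
    let c : ℕ →o Ideal R := 
      { toFun := fun n => Ideal.torsionOf R R (s ^ n)
        monotone' := fun n m hnm r hr => by
          rw [Ideal.mem_torsionOf_iff, smul_eq_mul] at hr ⊢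
          obtain ⟨t, rfl⟩ := Nat.exists_eq_add_of_le hnm
          rw [pow_add, ← mul_assoc, hr, zero_mul] }
    obtain ⟨k, hk⟩ := monotone_stabilizes_iff_noetherian.2 ‹_› c
    refine ⟨k, fun r hr => ?_⟩
    have : r ∈ c (k + 1) := (Ideal.mem_torsionOf_iff _ _).2 (by simpa [mul_comm] using hr)
    rw [← hk (k + 1) (by omega)] at this
    simpa [mul_comm] using (Ideal.mem_torsionOf_iff _ _).1 this
  -- Multiplications by s^k and s^{k+1} have the same kernel, so s^{k+1} ↦ s^k z is well defined on
  -- the ideal (s^{k+1}); injectivity extends it to R.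
  let φ : R →ₗ[R] R := LinearMap.mulLeft R (s ^ (k + 1))
  let ψ : R →ₗ[R] E := LinearMap.toSpanSingleton R E (s ^ k • z)
  have hψ : LinearMap.ker φ ≤ LinearMap.ker ψ := by
    intro r hr
    have := hk r hr
    simp [ψ, smul_smul, mul_comm r, this]
  obtain ⟨h, hh⟩ := Module.Injective.out ((LinearMap.ker φ).liftQ φ le_rfl)
    (LinearMap.ker_eq_bot.1 (Submodule.ker_liftQ_eq_bot _ _ _ le_rfl))
    ((LinearMap.ker φ).liftQ ψ hψ)
  refine ⟨k, h 1, ?_⟩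
  have h1 := hh (Submodule.Quotient.mk 1)
  rw [Submodule.liftQ_apply, Submodule.liftQ_apply] at h1
  rw [← map_smul, smul_eq_mul, mul_one]
  simpa [φ, ψ] using h1

end TorsionPart

/-! ### Injective resolutions spliced from syzygies -/

section Resolution

open CategoryTheory.Limits

universe v w

variable {C : Type w} [Category.{v} C] [Abelian C]

variable (C) in
/-- A sequence of short exact sequences `0 → Z n → E n → Z (n + 1) → 0` with `E n` injective. -/
structure SyzygySequence where
  /-- the syzygies -/
  Z : ℕ → C
  /-- the injective objects -/
  E : ℕ → C
  /-- the embedding of a syzygy -/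
  i : ∀ n, Z n ⟶ E n
  /-- the projection to the next syzygy -/
  p : ∀ n, E n ⟶ Z (n + 1)
  w : ∀ n, i n ≫ p n = 0
  shortExact : ∀ n, (ShortComplex.mk (i n) (p n) (w n)).ShortExact
  injective : ∀ n, Injective (E n)

namespace SyzygySequence

variable (s : SyzygySequence C)

instance (n : ℕ) : Mono (s.i n) := (s.shortExact n).mono_f

instance (n : ℕ) : Epi (s.p n) := (s.shortExact n).epi_g

@[simp]
theorem i_p (n : ℕ) : s.i n ≫ s.p n = 0 := s.w n

@[simp]
theorem i_p_assoc (n : ℕ) {X : C} (h : s.Z (n + 1) ⟶ X) : s.i n ≫ s.p n ≫ h = 0 := by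
  rw [← Category.assoc, s.w, zero_comp]

/-- The cochain complex `E 0 → E 1 → ⋯` of a sequence of syzygies. -/
noncomputable abbrev cocomplex : CochainComplex C ℕ :=
  CochainComplex.of s.E (fun n => s.p n ≫ s.i (n + 1)) (fun n => by simp)

theorem cocomplex_d (n : ℕ) : s.cocomplex.d n (n + 1) = s.p n ≫ s.i (n + 1) := by simp

theorem exact_i_d (n : ℕ) :
    (ShortComplex.mk (s.i n) (s.p n ≫ s.i (n + 1)) (by simp)).Exact := by
  let α : ShortComplex.mk (s.i n) (s.p n) (s.w n) ⟶
      ShortComplex.mk (s.i n) (s.p n ≫ s.i (n + 1)) (by simp) :=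
    { τ₁ := 𝟙 _
      τ₂ := 𝟙 _
      τ₃ := s.i (n + 1) }
  have : Epi α.τ₁ := inferInstanceAs (Epi (𝟙 _))
  have : IsIso α.τ₂ := inferInstanceAs (IsIso (𝟙 _))
  have : Mono α.τ₃ := inferInstanceAs (Mono (s.i (n + 1)))
  exact (ShortComplex.exact_iff_of_epi_of_isIso_of_mono α).1 (s.shortExact n).exact

theorem exact_d_d (n : ℕ) :
    (ShortComplex.mk (s.p n ≫ s.i (n + 1)) (s.p (n + 1) ≫ s.i (n + 2)) (by simp)).Exact := by
  let α : ShortComplex.mk (s.p n ≫ s.i (n + 1)) (s.p (n + 1) ≫ s.i (n + 2)) (by simp) ⟶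
      ShortComplex.mk (s.i (n + 1)) (s.p (n + 1) ≫ s.i (n + 2)) (by simp) :=
    { τ₁ := s.p n
      τ₂ := 𝟙 _
      τ₃ := 𝟙 _ }
  have : Epi α.τ₁ := inferInstanceAs (Epi (s.p n))
  have : IsIso α.τ₂ := inferInstanceAs (IsIso (𝟙 _))
  have : Mono α.τ₃ := inferInstanceAs (Mono (𝟙 _))
  exact (ShortComplex.exact_iff_of_epi_of_isIso_of_mono α).2 (s.exact_i_d (n + 1))

theorem cocomplex_exactAt_succ (n : ℕ) : s.cocomplex.ExactAt (n + 1) := by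
  rw [HomologicalComplex.exactAt_iff' _ n (n + 1) (n + 2) (by simp) (by simp)]
  refine (ShortComplex.exact_iff_of_iso ?_).1 (s.exact_d_d n)
  exact ShortComplex.isoMk (Iso.refl _) (Iso.refl _) (Iso.refl _)
    ((Category.id_comp _).trans ((s.cocomplex_d n).trans (Category.comp_id _).symm))
    ((Category.id_comp _).trans ((s.cocomplex_d (n + 1)).trans (Category.comp_id _).symm))

/-- The injective resolution of `Z 0` given by a sequence of syzygies. -/
noncomputable def resolution : InjectiveResolution (s.Z 0) where
  cocomplex := s.cocomplex
  injective := s.injective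
  ι := (CochainComplex.fromSingle₀Equiv _ _).symm ⟨s.i 0, by rw [cocomplex_d]; simp⟩
  quasiIso := ⟨fun n => by
    cases n
    · rw [CochainComplex.quasiIsoAt₀_iff, ShortComplex.quasiIso_iff_of_zeros]
      · refine (ShortComplex.exact_and_mono_f_iff_of_iso ?_).2
          ⟨s.exact_i_d 0, by dsimp; infer_instance⟩
        exact ShortComplex.isoMk (Iso.refl _) (Iso.refl _) (Iso.refl _)
          ((Category.id_comp _).trans (Eq.trans (by simp [CochainComplex.fromSingle₀Equiv]; rfl)
            (Category.comp_id _).symm))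
          ((Category.id_comp _).trans ((s.cocomplex_d 0).symm.trans (Category.comp_id _).symm))
      all_goals rfl
    · rw [quasiIsoAt_iff_exactAt]
      · apply s.cocomplex_exactAt_succ
      · apply CochainComplex.exactAt_succ_single_obj⟩

@[simp]
theorem resolution_ι_f_zero : s.resolution.ι.f 0 = s.i 0 := by
  simp [resolution, CochainComplex.fromSingle₀Equiv]

end SyzygySequence

section CokernelRow

variable {S T : ShortComplex C} (φ : S ⟶ T)

/-- Snake lemma: the kernel row is zero, so the connecting morphism is too. This lets the rows of a
horseshoe resolution be iterated. -/
theorem shortExact_cokernel (hS : S.ShortExact) (hT : T.ShortExact) [Mono φ] :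
    (cokernel φ).ShortExact := by
  let D : ShortComplex.SnakeInput C :=
    { L₀ := kernel φ
      L₁ := S
      L₂ := T
      L₃ := cokernel φ
      v₀₁ := kernel.ι φ
      v₁₂ := φ
      v₂₃ := cokernel.π φ
      w₀₂ := by simp
      w₁₃ := by simp
      h₀ := kernelIsKernel φ
      h₃ := cokernelIsCokernel φ
      L₁_exact := hS.exact
      epi_L₁_g := hS.epi_g
      L₂_exact := hT.exact
      mono_L₂_f := hT.mono_f }
  have h₁ : Mono (cokernel φ).f := by
    have hz : IsZero D.L₀.X₃ := (ShortComplex.π₃ (C := C)).map_isZero (isZero_kernel_of_mono φ)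
    have h0 : D.δ = 0 := hz.eq_of_src _ _
    exact D.L₂'_exact.mono_g h0
  have h₂ : Epi (cokernel φ).g :=
    @ShortComplex.SnakeInput.epi_L₃_g _ _ _ D hT.epi_g
  exact ShortComplex.ShortExact.mk' D.L₃_exact h₁ h₂

end CokernelRow

end Resolution

/-! ### Horseshoe resolutions of a short exact sequence -/

section LongExactSequence

open CategoryTheory.Limits

universe v w

variable {C : Type w} [Category.{v} C] [Abelian C] [EnoughInjectives C]

/-- The split short complex of injective objects in which a short complex embeds. -/
noncomputable abbrev injectiveRow (S : ShortComplex C) : ShortComplex C :=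
  ShortComplex.mk (biprod.inl : Injective.under S.X₂ ⟶ Injective.under S.X₂ ⊞ Injective.under S.X₃)
    biprod.snd (by simp)

/-- The splitting of `injectiveRow S`. -/
noncomputable def injectiveRowSplitting (S : ShortComplex C) : (injectiveRow S).Splitting where
  r := biprod.fst
  s := biprod.inr

/-- The canonical morphism to `injectiveRow S`. -/
noncomputable abbrev toInjectiveRow (S : ShortComplex C) : S ⟶ injectiveRow S where
  τ₁ := S.f ≫ Injective.ι S.X₂
  τ₂ := biprod.lift (Injective.ι S.X₂) (S.g ≫ Injective.ι S.X₃)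
  τ₃ := Injective.ι S.X₃
  comm₁₂ := by ext <;> simp

theorem mono_toInjectiveRow_τ₂ (S : ShortComplex C) : Mono (toInjectiveRow S).τ₂ :=
  mono_of_mono_fac (biprod.lift_fst (Injective.ι S.X₂) (S.g ≫ Injective.ι S.X₃))

theorem mono_toInjectiveRow {S : ShortComplex C} (hS : S.ShortExact) : Mono (toInjectiveRow S) := by
  have := hS.mono_f
  have := mono_toInjectiveRow_τ₂ S
  refine ⟨fun g h hgh => ?_⟩
  ext
  · rw [← cancel_mono (toInjectiveRow S).τ₁]
    exact congrArg ShortComplex.Hom.τ₁ hgh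
  · rw [← cancel_mono (toInjectiveRow S).τ₂]
    exact congrArg ShortComplex.Hom.τ₂ hgh
  · rw [← cancel_mono (toInjectiveRow S).τ₃]
    exact congrArg ShortComplex.Hom.τ₃ hgh

/-- The iterated syzygies of a short exact sequence. -/
noncomputable def rowSyzygy (S : {S : ShortComplex C // S.ShortExact}) :
    ℕ → {S : ShortComplex C // S.ShortExact}
  | 0 => S
  | n + 1 => ⟨cokernel (toInjectiveRow (rowSyzygy S n).1),
      have := mono_toInjectiveRow (rowSyzygy S n).2
      shortExact_cokernel _ (rowSyzygy S n).2 (injectiveRowSplitting _).shortExact⟩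

variable (S : {S : ShortComplex C // S.ShortExact})

/-- The projection from the `n`-th row of injective objects to the next row of syzygies. -/
noncomputable def rowProj (n : ℕ) :
    injectiveRow (rowSyzygy S n).1 ⟶ (rowSyzygy S (n + 1)).1 :=
  cokernel.π (toInjectiveRow (rowSyzygy S n).1)

theorem rowProj_w (n : ℕ) : toInjectiveRow (rowSyzygy S n).1 ≫ rowProj S n = 0 :=
  cokernel.condition _

theorem shortExact_map_row (G : ShortComplex C ⥤ C) [G.PreservesZeroMorphisms]
    [PreservesFiniteLimits G]
    [PreservesFiniteColimits G] (n : ℕ) :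
    (ShortComplex.mk (G.map (toInjectiveRow (rowSyzygy S n).1)) (G.map (rowProj S n))
      (by rw [← G.map_comp, rowProj_w, G.map_zero])).ShortExact := by
  have := mono_toInjectiveRow (rowSyzygy S n).2
  have : (ShortComplex.mk (toInjectiveRow (rowSyzygy S n).1) (rowProj S n)
      (rowProj_w S n)).ShortExact :=
    ShortComplex.ShortExact.mk' (ShortComplex.exact_cokernel _) this
      (inferInstanceAs (Epi (cokernel.π (toInjectiveRow (rowSyzygy S n).1))))
  exact this.map_of_exact G

/-- The syzygies of the left hand object of a short exact sequence. -/
noncomputable def syzygy₁ : SyzygySequence C where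
  Z n := (rowSyzygy S n).1.X₁
  E n := (injectiveRow (rowSyzygy S n).1).X₁
  i n := (toInjectiveRow (rowSyzygy S n).1).τ₁
  p n := (rowProj S n).τ₁
  w n := congrArg ShortComplex.Hom.τ₁ (rowProj_w S n)
  shortExact n := shortExact_map_row S ShortComplex.π₁ n
  injective _ := inferInstanceAs (Injective (Injective.under _))

/-- The syzygies of the middle object of a short exact sequence. -/
noncomputable def syzygy₂ : SyzygySequence C where
  Z n := (rowSyzygy S n).1.X₂
  E n := (injectiveRow (rowSyzygy S n).1).X₂
  i n := (toInjectiveRow (rowSyzygy S n).1).τ₂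
  p n := (rowProj S n).τ₂
  w n := congrArg ShortComplex.Hom.τ₂ (rowProj_w S n)
  shortExact n := shortExact_map_row S ShortComplex.π₂ n
  injective _ := inferInstanceAs (Injective (Injective.under _ ⊞ Injective.under _))

/-- The syzygies of the right hand object of a short exact sequence. -/
noncomputable def syzygy₃ : SyzygySequence C where
  Z n := (rowSyzygy S n).1.X₃
  E n := (injectiveRow (rowSyzygy S n).1).X₃
  i n := (toInjectiveRow (rowSyzygy S n).1).τ₃
  p n := (rowProj S n).τ₃
  w n := congrArg ShortComplex.Hom.τ₃ (rowProj_w S n)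
  shortExact n := shortExact_map_row S ShortComplex.π₃ n
  injective _ := inferInstanceAs (Injective (Injective.under _))

/-- The map of resolutions lifting the first map of a short exact sequence. -/
noncomputable def resolutionMap₁₂ : (syzygy₁ S).cocomplex ⟶ (syzygy₂ S).cocomplex :=
  CochainComplex.ofHom (fun n => (injectiveRow (rowSyzygy S n).1).f) fun n => by
    rw [SyzygySequence.cocomplex_d, SyzygySequence.cocomplex_d]
    have h₁ := (rowProj S n).comm₁₂
    have h₂ := (toInjectiveRow (rowSyzygy S (n + 1)).1).comm₁₂
    simp only [syzygy₁, syzygy₂]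
    rw [← reassoc_of% h₁, Category.assoc, h₂]

/-- The map of resolutions lifting the second map of a short exact sequence. -/
noncomputable def resolutionMap₂₃ : (syzygy₂ S).cocomplex ⟶ (syzygy₃ S).cocomplex :=
  CochainComplex.ofHom (fun n => (injectiveRow (rowSyzygy S n).1).g) fun n => by
    rw [SyzygySequence.cocomplex_d, SyzygySequence.cocomplex_d]
    have h₁ := (rowProj S n).comm₂₃
    have h₂ := (toInjectiveRow (rowSyzygy S (n + 1)).1).comm₂₃
    simp only [syzygy₂, syzygy₃]
    rw [← reassoc_of% h₁, Category.assoc, h₂]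

theorem resolutionMap_comp : resolutionMap₁₂ S ≫ resolutionMap₂₃ S = 0 := by
  ext n
  exact (injectiveRow (rowSyzygy S n).1).zero

variable {D : Type*} [Category* D] [Abelian D] (F : C ⥤ D) [F.Additive]

/-- The short complex of complexes obtained by applying `F` to the resolutions. -/
noncomputable abbrev mappedResolutions : ShortComplex (CochainComplex D ℕ) :=
  ShortComplex.mk ((F.mapHomologicalComplex _).map (resolutionMap₁₂ S))
    ((F.mapHomologicalComplex _).map (resolutionMap₂₃ S))
    (by rw [← Functor.map_comp, resolutionMap_comp, Functor.map_zero])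

/-- Each row of injectives is split, so any additive functor keeps it exact. -/
theorem mappedResolutions_shortExact : (mappedResolutions S F).ShortExact :=
  HomologicalComplex.shortExact_of_degreewise_shortExact _ fun n =>
    ((injectiveRowSplitting (rowSyzygy S n).1).map F).shortExact

theorem rightDerived_map_f (n : ℕ) :
    (F.rightDerived n).map S.1.f ≫ ((syzygy₂ S).resolution.isoRightDerivedObj F n).hom =
      ((syzygy₁ S).resolution.isoRightDerivedObj F n).hom ≫
        HomologicalComplex.homologyMap (mappedResolutions S F).f n :=
  InjectiveResolution.isoRightDerivedObj_hom_naturality S.1.f (syzygy₁ S).resolution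
    (syzygy₂ S).resolution (resolutionMap₁₂ S)
    (by
      rw [SyzygySequence.resolution_ι_f_zero, SyzygySequence.resolution_ι_f_zero]
      exact (toInjectiveRow S.1).comm₁₂) F n

theorem rightDerived_map_g (n : ℕ) :
    (F.rightDerived n).map S.1.g ≫ ((syzygy₃ S).resolution.isoRightDerivedObj F n).hom =
      ((syzygy₂ S).resolution.isoRightDerivedObj F n).hom ≫
        HomologicalComplex.homologyMap (mappedResolutions S F).g n :=
  InjectiveResolution.isoRightDerivedObj_hom_naturality S.1.g (syzygy₂ S).resolution
    (syzygy₃ S).resolution (resolutionMap₂₃ S)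
    (by
      rw [SyzygySequence.resolution_ι_f_zero, SyzygySequence.resolution_ι_f_zero]
      exact (toInjectiveRow S.1).comm₂₃) F n

end LongExactSequence

/-! ### The long exact sequence and scalar action for right derived functors -/

section

universe v w

theorem exact_of_commSq {D : Type*} [Category* D] [Abelian D] {X₁ X₂ X₃ Y₁ Y₂ Y₃ : D}
    {f : X₁ ⟶ X₂} {g : X₂ ⟶ X₃} {f' : Y₁ ⟶ Y₂} {g' : Y₂ ⟶ Y₃} (e₁ : X₁ ≅ Y₁) (e₂ : X₂ ≅ Y₂)
    (e₃ : X₃ ≅ Y₃) (hf : f ≫ e₂.hom = e₁.hom ≫ f') (hg : g ≫ e₃.hom = e₂.hom ≫ g')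
    {w : f' ≫ g' = 0} (h : (ShortComplex.mk f' g' w).Exact) :
    ∃ w : f ≫ g = 0, (ShortComplex.mk f g w).Exact := by
  have w' : f ≫ g = 0 := by
    rw [← cancel_mono e₃.hom, Category.assoc, hg, reassoc_of% hf, w, Limits.comp_zero,
      Limits.zero_comp]
  refine ⟨w', (ShortComplex.exact_iff_of_iso ?_).2 h⟩
  exact ShortComplex.isoMk e₁ e₂ e₃ hf.symm hg.symm

variable {C : Type w} [Category.{v} C] [Abelian C] [EnoughInjectives C]
  {D : Type*} [Category* D] [Abelian D]

/-- Right derived functors are exact in the middle. -/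
theorem rightDerived_exact₂ (F : C ⥤ D) [F.Additive] {S : ShortComplex C} (hS : S.ShortExact)
    (n : ℕ) : ∃ w : (F.rightDerived n).map S.f ≫ (F.rightDerived n).map S.g = 0,
      (ShortComplex.mk _ _ w).Exact :=
  exact_of_commSq ((syzygy₁ ⟨S, hS⟩).resolution.isoRightDerivedObj F n)
    ((syzygy₂ ⟨S, hS⟩).resolution.isoRightDerivedObj F n)
    ((syzygy₃ ⟨S, hS⟩).resolution.isoRightDerivedObj F n)
    (rightDerived_map_f ⟨S, hS⟩ F n) (rightDerived_map_g ⟨S, hS⟩ F n)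
    ((mappedResolutions_shortExact ⟨S, hS⟩ F).homology_exact₂ n)

theorem exists_connecting_of_commSq {X₂ X₃ X₁' X₂' Y₂ Y₃ Y₁' Y₂' : D} {a : X₂ ⟶ X₃}
    {b : Y₂ ⟶ Y₃} {c : X₁' ⟶ X₂'} {d : Y₁' ⟶ Y₂'} (e₂ : X₂ ≅ Y₂) (e₃ : X₃ ≅ Y₃)
    (e₁' : X₁' ≅ Y₁') (e₂' : X₂' ≅ Y₂') (ha : a ≫ e₃.hom = e₂.hom ≫ b)
    (hc : c ≫ e₂'.hom = e₁'.hom ≫ d) {δ : Y₃ ⟶ Y₁'} {w₁ : b ≫ δ = 0} {w₂ : δ ≫ d = 0}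
    (h₁ : (ShortComplex.mk b δ w₁).Exact) (h₂ : (ShortComplex.mk δ d w₂).Exact) :
    ∃ (δ : X₃ ⟶ X₁') (w₁ : a ≫ δ = 0) (w₂ : δ ≫ c = 0),
      (ShortComplex.mk a δ w₁).Exact ∧ (ShortComplex.mk δ c w₂).Exact := by
  have hδ : (e₃.hom ≫ δ ≫ e₁'.inv) ≫ e₁'.hom = e₃.hom ≫ δ := by simp
  obtain ⟨w, h⟩ := exact_of_commSq e₂ e₃ e₁' ha hδ h₁
  obtain ⟨w', h'⟩ := exact_of_commSq e₃ e₁' e₂' hδ hc h₂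
  exact ⟨_, w, w', h, h'⟩

/-- The connecting morphism of the long exact sequence of right derived functors. -/
theorem exists_connecting (F : C ⥤ D) [F.Additive] {S : ShortComplex C} (hS : S.ShortExact)
    (n : ℕ) :
    ∃ (δ : (F.rightDerived n).obj S.X₃ ⟶ (F.rightDerived (n + 1)).obj S.X₁)
      (w₁ : (F.rightDerived n).map S.g ≫ δ = 0) (w₂ : δ ≫ (F.rightDerived (n + 1)).map S.f = 0),
      (ShortComplex.mk _ _ w₁).Exact ∧ (ShortComplex.mk _ _ w₂).Exact :=
  exists_connecting_of_commSq ((syzygy₂ ⟨S, hS⟩).resolution.isoRightDerivedObj F n)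
    ((syzygy₃ ⟨S, hS⟩).resolution.isoRightDerivedObj F n)
    ((syzygy₁ ⟨S, hS⟩).resolution.isoRightDerivedObj F (n + 1))
    ((syzygy₂ ⟨S, hS⟩).resolution.isoRightDerivedObj F (n + 1))
    (rightDerived_map_g ⟨S, hS⟩ F n) (rightDerived_map_f ⟨S, hS⟩ F (n + 1))
    ((mappedResolutions_shortExact ⟨S, hS⟩ F).homology_exact₃ n (n + 1) rfl)
    ((mappedResolutions_shortExact ⟨S, hS⟩ F).homology_exact₁ n (n + 1) rfl)

/-- A scalar acts on the right derived functors of a linear functor by scalar multiplication. -/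
theorem rightDerived_map_smul {R : Type*} [CommRing R] [CategoryTheory.Linear R C]
    [CategoryTheory.Linear R D]
    (F : C ⥤ D) [F.Additive] [F.Linear R] (n : ℕ) (X : C) (r : R) :
    (F.rightDerived n).map (r • 𝟙 X) = r • 𝟙 ((F.rightDerived n).obj X) := by
  let P := injectiveResolution X
  rw [F.rightDerived_map_eq n (r • 𝟙 X) (P := P) (Q := P) (r • 𝟙 P.cocomplex)
    (by
      ext
      simp only [Linear.comp_smul, HomologicalComplex.smul_f_apply, HomologicalComplex.comp_f,
        Category.comp_id, CochainComplex.single₀_map_f_zero]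
      exact ((Linear.smul_comp X X (P.cocomplex.X 0) r (𝟙 X) (P.ι.f 0)).trans
        (congrArg (r • ·) (Category.id_comp (X := X) _))).symm)]
  have : (F.mapHomologicalComplex _ ⋙ HomologicalComplex.homologyFunctor D _ n).map
      (r • 𝟙 P.cocomplex) = r • 𝟙 _ := by
    rw [Functor.comp_map, Functor.map_smul, CategoryTheory.Functor.map_id]
    exact (ShortComplex.homologyMap_smul (S₁ := _) (S₂ := _) (𝟙 _) r).trans
      (congrArg (r • ·) (ShortComplex.homologyMap_id _))
  rw [this]
  simp

end

/-! ### Resolutions by power torsion injectives -/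

section TorsionResolution

variable {R : Type u} [CommRing R] {A : Ideal R}

variable (A) in
/-- Every element of `N` is killed by a power of every element of `A`. -/
def IsPowerTorsion (N : Type u) [AddCommGroup N] [Module R N] : Prop :=
  ∀ x : N, A ≤ (Ideal.torsionOf R N x).radical

theorem IsPowerTorsion.of_map {N N' : Type u} [AddCommGroup N] [Module R N] [AddCommGroup N']
    [Module R N'] (h : IsPowerTorsion A N) (f : N →ₗ[R] N') (hf : Function.Surjective f) :
    IsPowerTorsion A N' := by
  intro y
  obtain ⟨x, rfl⟩ := hf y
  refine (h x).trans (Ideal.radical_mono fun r hr => ?_)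
  rw [Ideal.mem_torsionOf_iff] at hr ⊢
  rw [← map_smul, hr, map_zero]

variable [IsNoetherianRing R]

theorem mem_torsionPart_bot_iff {N : Type u} [AddCommGroup N] [Module R N] {x : N} :
    x ∈ torsionPart A ⊥ N ↔ A ≤ (Ideal.torsionOf R N x).radical := by
  rw [mem_torsionPart_iff, sup_bot_eq]

theorem isPowerTorsion_torsionPart (N : Type u) [AddCommGroup N] [Module R N] :
    IsPowerTorsion A (torsionPart A ⊥ N) := by
  rintro ⟨x, hx⟩
  refine (mem_torsionPart_bot_iff.1 hx).trans (Ideal.radical_mono fun r hr => ?_)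
  rw [Ideal.mem_torsionOf_iff] at hr ⊢
  exact Subtype.ext hr

section

variable (N : ModuleCat.{u} R)

/-- The `A`-power torsion part of an injective object containing `N`. -/
noncomputable abbrev torsionUnder (A : Ideal R) : Type u :=
  torsionPart A ⊥ (Injective.under N : ModuleCat.{u} R)

theorem injective_torsionUnder : Module.Injective R (torsionUnder N A) := by
  have : Injective (ModuleCat.of R (Injective.under N : ModuleCat.{u} R)) :=
    inferInstanceAs (Injective (Injective.under N))
  have := Module.injective_module_of_injective_object R (Injective.under N : ModuleCat.{u} R)
  exact injective_torsionPart A ⊥ _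

variable {N}

/-- The embedding of an `A`-power torsion module in an `A`-power torsion injective module. -/
noncomputable def toTorsionUnder (hN : IsPowerTorsion A N) : N →ₗ[R] torsionUnder N A :=
  LinearMap.codRestrict _ (Injective.ι N).hom fun x => by
    rw [mem_torsionPart_bot_iff]
    refine (hN x).trans (Ideal.radical_mono fun r hr => ?_)
    rw [Ideal.mem_torsionOf_iff] at hr ⊢
    rw [← map_smul, hr, map_zero]

theorem toTorsionUnder_injective (hN : IsPowerTorsion A N) :
    Function.Injective (toTorsionUnder hN) := by
  intro x y hxy
  exact (ModuleCat.mono_iff_injective (Injective.ι N)).1 inferInstance (congrArg Subtype.val hxy)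

end

/-- The iterated syzygies of an `A`-power torsion module in `A`-power torsion injectives. -/
noncomputable def torsionSyzygy (N : {N : ModuleCat.{u} R // IsPowerTorsion A N}) :
    ℕ → {N : ModuleCat.{u} R // IsPowerTorsion A N}
  | 0 => N
  | n + 1 => ⟨ModuleCat.of R (torsionUnder (torsionSyzygy N n).1 A ⧸
        LinearMap.range (toTorsionUnder (torsionSyzygy N n).2)),
      (isPowerTorsion_torsionPart _).of_map (Submodule.mkQ _) (Submodule.mkQ_surjective _)⟩

/-- The syzygy sequence of an `A`-power torsion module. -/
noncomputable def torsionSyzygySequence (N : {N : ModuleCat.{u} R // IsPowerTorsion A N}) :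
    SyzygySequence (ModuleCat.{u} R) where
  Z n := (torsionSyzygy N n).1
  E n := ModuleCat.of R (torsionUnder (torsionSyzygy N n).1 A)
  i n := ModuleCat.ofHom (toTorsionUnder (torsionSyzygy N n).2)
  p n := ModuleCat.ofHom (Submodule.mkQ (LinearMap.range (toTorsionUnder (torsionSyzygy N n).2)))
  w n := by
    ext x
    exact (Submodule.Quotient.mk_eq_zero _).2 ⟨x, rfl⟩
  shortExact n := by
    refine ModuleCat.shortComplex_shortExact _ ?_
      (toTorsionUnder_injective (torsionSyzygy N n).2)
      (Submodule.mkQ_surjective _)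
    intro x
    exact Submodule.Quotient.mk_eq_zero _
  injective n := (Module.injective_iff_injective_object R _).1 (injective_torsionUnder _)

/-- An `A`-power torsion module has a resolution by `A`-power torsion injective modules. -/
theorem exists_torsion_injectiveResolution (N : ModuleCat.{u} R) (hN : IsPowerTorsion A N) :
    ∃ P : InjectiveResolution N, ∀ n, IsPowerTorsion A (P.cocomplex.X n) :=
  ⟨(torsionSyzygySequence ⟨N, hN⟩).resolution, fun _ => isPowerTorsion_torsionPart _⟩

end TorsionResolution

/-! ### Local cohomology in terms of elements of a resolution -/

section Computation

variable {R : Type u} [CommRing R] (I J : Ideal R)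

instance : (torsionFunctor I J).Linear R where

variable {I J} in
theorem PowSmulSubset.of_injective {M N : Type u} [AddCommGroup M] [Module R M]
    [AddCommGroup N] [Module R N] {f : M →ₗ[R] N} (hf : Function.Injective f) {n : ℕ} {x : M}
    (hx : PowSmulSubset I J n (f x)) : PowSmulSubset I J n x := by
  intro a ha
  obtain ⟨b, hb, hab⟩ := hx a ha
  exact ⟨b, hb, hf (by rw [map_smul, hab, map_smul])⟩

instance : Limits.PreservesFiniteLimits (torsionFunctor I J) := by
  refine ((torsionFunctor I J).preservesFiniteLimits_tfae.out 0 3).1 ?_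
  intro S hS
  constructor
  · rw [ShortComplex.moduleCat_exact_iff]
    rintro ⟨x, n, hx⟩ hgx
    obtain ⟨y, rfl⟩ := (ShortComplex.moduleCat_exact_iff S).1 hS.exact x (congrArg Subtype.val hgx)
    exact ⟨⟨y, n, hx.of_injective hS.moduleCat_injective_f⟩, rfl⟩
  · rw [ModuleCat.mono_iff_injective]
    intro x y hxy
    exact Subtype.ext (hS.moduleCat_injective_f (congrArg Subtype.val hxy))

/-- `H^0_{I,J}(N)` is `Γ_{I,J}(N)`. -/
noncomputable def localCohomologyPairZeroEquiv (N : ModuleCat.{u} R) :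
    (localCohomologyPair I J 0).obj N ≃ₗ[R] torsionPart I J N :=
  ((torsionFunctor I J).rightDerivedZeroIsoSelf.app N).toLinearEquiv

variable {I J} {N : ModuleCat.{u} R} (P : InjectiveResolution N)

theorem exists_d_eq (n : ℕ) (x : P.cocomplex.X (n + 1))
    (hx : P.cocomplex.d (n + 1) (n + 2) x = 0) : ∃ y, P.cocomplex.d n (n + 1) y = x :=
  (ShortComplex.moduleCat_exact_iff _).1 (P.exact_succ n) x hx

theorem subsingleton_localCohomologyPair_succ (n : ℕ)
    (h : ∀ x ∈ torsionPart I J (P.cocomplex.X (n + 1)), P.cocomplex.d (n + 1) (n + 2) x = 0 →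
      ∃ y ∈ torsionPart I J (P.cocomplex.X n), P.cocomplex.d n (n + 1) y = x) :
    Subsingleton ((localCohomologyPair I J (n + 1)).obj N) := by
  rw [← ModuleCat.isZero_iff_subsingleton]
  refine Limits.IsZero.of_iso ?_ (P.isoRightDerivedObj (torsionFunctor I J) (n + 1))
  refine (HomologicalComplex.exactAt_iff_isZero_homology _ _).1 ?_
  rw [HomologicalComplex.exactAt_iff' _ n (n + 1) (n + 2) (by simp) (by simp),
    ShortComplex.moduleCat_exact_iff]
  rintro ⟨x, hx⟩ hx'
  obtain ⟨y, hy, hyx⟩ := h x hx (congrArg Subtype.val hx')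
  exact ⟨⟨y, hy⟩, Subtype.ext hyx⟩

/-- Cohomology is a subquotient of the torsion part: lift the class to a cocycle and use the scalar
that kills it. -/
theorem exists_smul_eq_zero_of_forall (n : ℕ) (S : Set R)
    (h : ∀ x ∈ torsionPart I J (P.cocomplex.X n), ∃ r ∈ S, r • x = 0)
    (z : (localCohomologyPair I J n).obj N) : ∃ r ∈ S, r • z = 0 := by
  let K := ((torsionFunctor I J).mapHomologicalComplex (ComplexShape.up ℕ)).obj P.cocomplex
  let e : (localCohomologyPair I J n).obj N ≅ K.homology n :=
    P.isoRightDerivedObj (torsionFunctor I J) n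
  obtain ⟨c, hc⟩ := (ModuleCat.epi_iff_surjective (K.homologyπ n)).1 inferInstance (e.hom z)
  obtain ⟨r, hr, hrx⟩ := h (K.iCycles n c).1 (K.iCycles n c).2
  refine ⟨r, hr, ?_⟩
  have h1 : r • c = 0 := by
    apply (ModuleCat.mono_iff_injective (K.iCycles n)).1 inferInstance
    rw [map_smul, map_zero]
    exact Subtype.ext hrx
  apply (ModuleCat.mono_iff_injective e.hom).1 inferInstance
  rw [map_smul, map_zero, ← hc, ← map_smul, h1, map_zero]

end Computation

/-! ### Vanishing above the number of generators -/

section Vanishing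

theorem exists_pow_eq_pow_add {R : Type u} [CommRing R] {J : Ideal R} {a b : R} (hb : b ∈ J)
    (n k : ℕ) :
    ∃ c ∈ J, (a ^ n + b) ^ k = a ^ (n * k) + c := by
  refine ⟨(a ^ n + b) ^ k - a ^ (n * k), ?_, by ring⟩
  rw [pow_mul]
  obtain ⟨d, hd⟩ := sub_dvd_pow_sub_pow (a ^ n + b) (a ^ n) k
  rw [hd, add_sub_cancel_left]
  exact J.mul_mem_right _ hb

variable {R : Type u} [CommRing R] [IsNoetherianRing R] {I J : Ideal R}

theorem mem_torsionPart_span_singleton_iff {M : Type u} [AddCommGroup M] [Module R M] {a : R}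
    {x : M} : x ∈ torsionPart (Ideal.span {a}) J M ↔ ∃ (n : ℕ), ∃ b ∈ J, (a ^ n + b) • x = 0 := by
  rw [mem_torsionPart_iff, Ideal.span_singleton_le_iff_mem]
  refine exists_congr fun n => ?_
  rw [Submodule.mem_sup]
  constructor
  · rintro ⟨c, hc, b, hb, h⟩
    exact ⟨-b, J.neg_mem hb, by rw [← h, add_neg_cancel_right]; exact hc⟩
  · rintro ⟨b, hb, h⟩
    exact ⟨a ^ n + b, h, -b, J.neg_mem hb, by simp⟩

/-- Some s = a^n + b with b in J kills d₁y, so sy is a cocycle and sy = d₀z. Divisibility of the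
injective module Γ_{l,J}(E₀) gives z' with s^{k+1}z' = s^k z. Then s^{k+1} kills y - d₀z', which has
the same boundary as y, and s^{k+1} is a power of a modulo J. -/
theorem exists_boundary_cons {l : Ideal R} {a : R} {E₀ E₁ E₂ : Type u} [AddCommGroup E₀]
    [Module R E₀] [AddCommGroup E₁] [Module R E₁] [AddCommGroup E₂] [Module R E₂]
    [Module.Injective R E₀] (d₀ : E₀ →ₗ[R] E₁) (d₁ : E₁ →ₗ[R] E₂) (hd : d₁ ∘ₗ d₀ = 0)
    (h₁ : ∀ x ∈ torsionPart l J E₁, d₁ x = 0 → ∃ y ∈ torsionPart l J E₀, d₀ y = x)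
    (y : E₁) (hy : y ∈ torsionPart l J E₁)
    (ha : d₁ y ∈ torsionPart (Ideal.span {a}) J E₂) :
    ∃ y' ∈ torsionPart (Ideal.span {a} ⊔ l) J E₁, d₁ y' = d₁ y := by
  obtain ⟨n, b, hb, hs⟩ := mem_torsionPart_span_singleton_iff.1 ha
  obtain ⟨z, hz, hzy⟩ := h₁ ((a ^ n + b) • y) (Submodule.smul_mem _ _ hy) (by rw [map_smul, hs])
  have := injective_torsionPart l J E₀
  obtain ⟨k, z', hz'⟩ := exists_pow_succ_smul_eq (torsionPart l J E₀) (a ^ n + b) ⟨z, hz⟩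
  have hz'' : (a ^ n + b) ^ (k + 1) • (z' : E₀) = (a ^ n + b) ^ k • z := congrArg Subtype.val hz'
  refine ⟨y - d₀ z', ?_, ?_⟩
  · rw [torsionPart_sup]
    refine ⟨?_, Submodule.sub_mem _ hy ?_⟩
    · obtain ⟨c, hc, hac⟩ := exists_pow_eq_pow_add (a := a) hb n (k + 1)
      refine mem_torsionPart_span_singleton_iff.2 ⟨n * (k + 1), c, hc, ?_⟩
      rw [← hac, smul_sub, ← map_smul, hz'', map_smul, hzy, smul_smul, ← pow_succ, sub_self]
    · obtain ⟨m, hm⟩ := z'.2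
      exact ⟨m, hm.map d₀⟩
  · rw [map_sub, ← LinearMap.comp_apply, hd, LinearMap.zero_apply, sub_zero]

/-- For the empty list every element is torsion and the claim is exactness of the resolution.
Adjoining an element uses the previous case in two consecutive degrees, hence the shift of the bound
by one. -/
theorem exists_boundary_ofList {N : ModuleCat.{u} R} (P : InjectiveResolution N) (l : List R) :
    ∀ n, l.length ≤ n → ∀ x ∈ torsionPart (Ideal.ofList l) J (P.cocomplex.X (n + 1)),
      P.cocomplex.d (n + 1) (n + 2) x = 0 →
      ∃ y ∈ torsionPart (Ideal.ofList l) J (P.cocomplex.X n), P.cocomplex.d n (n + 1) y = x := by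
  induction l with
  | nil =>
    intro n _ x _ hx
    obtain ⟨y, hy⟩ := exists_d_eq P n x hx
    refine ⟨y, ?_, hy⟩
    rw [Ideal.ofList_nil, mem_torsionPart_iff]
    exact bot_le
  | cons a l ih =>
    intro n hn x hx hdx
    obtain ⟨n, rfl⟩ : ∃ m, n = m + 1 := ⟨n - 1, by rw [List.length_cons] at hn; omega⟩
    rw [List.length_cons, Nat.succ_le_succ_iff] at hn
    rw [Ideal.ofList_cons] at hx ⊢
    rw [torsionPart_sup] at hx
    obtain ⟨y, hy, rfl⟩ := ih (n + 1) (by omega) x hx.2 hdx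
    have : Injective (ModuleCat.of R (P.cocomplex.X n)) := P.injective n
    have := Module.injective_module_of_injective_object R (P.cocomplex.X n)
    refine exists_boundary_cons (P.cocomplex.d n (n + 1)).hom (P.cocomplex.d (n + 1) (n + 2)).hom
      ?_ (ih n hn) y hy hx.1
    rw [← ModuleCat.hom_comp, P.cocomplex.d_comp_d, ModuleCat.hom_zero]

/-- On `A`-power torsion modules, `H^i_{I,J}` vanishes in degrees above the number of elements
that generate `I` up to radical modulo `A + J`. -/
theorem subsingleton_of_list {N : ModuleCat.{u} R} {A : Ideal R} (hN : IsPowerTorsion A N)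
    (l : List R) (h₁ : I ≤ (Ideal.ofList l ⊔ (A ⊔ J)).radical)
    (h₂ : Ideal.ofList l ≤ (I ⊔ (A ⊔ J)).radical) {i : ℕ} (hi : l.length < i) :
    Subsingleton ((localCohomologyPair I J i).obj N) := by
  obtain ⟨n, rfl⟩ : ∃ n, i = n + 1 := ⟨i - 1, by omega⟩
  obtain ⟨P, hP⟩ := exists_torsion_injectiveResolution N hN
  refine subsingleton_localCohomologyPair_succ P n fun x hx hdx => ?_
  obtain ⟨y, hy, hyx⟩ := exists_boundary_ofList P l n (by omega) x
    (torsionPart_le_of_le_radical h₂ (hP (n + 1)) hx) hdx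
  exact ⟨y, torsionPart_le_of_le_radical h₁ (hP n) hy, hyx⟩

end Vanishing

/-! ### Systems of parameters and vanishing above dim N/JN -/

section Parameters

open IsLocalRing

theorem radical_annihilator_quotient {R : Type u} [CommRing R] (J : Ideal R) (N : Type u)
    [AddCommGroup N] [Module R N] [Module.Finite R N] :
    (Module.annihilator R (N ⧸ (J • ⊤ : Submodule R N))).radical =
      (Module.annihilator R N ⊔ J).radical := by
  rw [← PrimeSpectrum.zeroLocus_eq_iff, ← Module.support_eq_zeroLocus, Module.support_quotient,
    Module.support_eq_zeroLocus, ← PrimeSpectrum.zeroLocus_sup]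

theorem isPowerTorsion_annihilator {R : Type u} [CommRing R] (N : Type u) [AddCommGroup N]
    [Module R N] :
    IsPowerTorsion (Module.annihilator R N) N := fun x =>
  le_trans (fun r hr => (Ideal.mem_torsionOf_iff x r).2 (Module.mem_annihilator.1 hr x))
    Ideal.le_radical

variable {R : Type u} [CommRing R] [IsNoetherianRing R] [IsLocalRing R]

/-- Existence of systems of parameters modulo an ideal. -/
theorem exists_list_radical_sup_eq (B : Ideal R) (hB : B ≤ maximalIdeal R) {r : ℕ}
    (hr : ringKrullDim (R ⧸ B) = r) :
    ∃ l : List R, l.length = r ∧ (Ideal.ofList l ⊔ B).radical = maximalIdeal R := by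
  have : Nontrivial (R ⧸ B) := Ideal.Quotient.nontrivial_iff.2
    (ne_top_of_le_ne_top (maximalIdeal.isMaximal R).ne_top hB)
  have : IsLocalRing (R ⧸ B) := .of_surjective' _ Ideal.Quotient.mk_surjective
  -- The maximal ideal is minimal over an ideal generated by as many elements as its height, which
  -- is the dimension of R/B.
  obtain ⟨s, hs, hcard⟩ :=
    (maximalIdeal (R ⧸ B)).exists_finset_card_eq_height_of_isNoetherianRing
  have hcard' : s.card = r := by
    have h1 := IsLocalRing.maximalIdeal_height_eq_ringKrullDim (R := R ⧸ B)
    rw [hr, ← hcard] at h1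
    exact_mod_cast h1
  let l : List R := s.toList.map Quotient.out
  have hl : (Ideal.ofList l).map (Ideal.Quotient.mk B) = Ideal.span s := by
    rw [Ideal.map_ofList]
    simp [l, Ideal.ofList, Function.comp_def]
  have hrad : (Ideal.span (s : Set (R ⧸ B))).radical = maximalIdeal (R ⧸ B) := by
    refine le_antisymm ((Ideal.IsPrime.radical_le_iff inferInstance).2 hs.1.2) ?_
    rw [Ideal.radical_eq_sInf]
    refine le_sInf fun p hp => ?_
    have := hp.2
    exact hs.2 ⟨hp.2, hp.1⟩ (le_maximalIdeal hp.2.ne_top)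
  refine ⟨l, by simp [l, hcard'], ?_⟩
  have hcomap : Ideal.ofList l ⊔ B =
      (Ideal.span (s : Set (R ⧸ B))).comap (Ideal.Quotient.mk B) := by
    rw [← hl, Ideal.comap_map_of_surjective _ Ideal.Quotient.mk_surjective,
      ← RingHom.ker_eq_comap_bot, Ideal.mk_ker]
  rw [hcomap, ← Ideal.comap_radical, hrad]
  have : IsLocalHom (Ideal.Quotient.mk B) := .of_surjective _ Ideal.Quotient.mk_surjective
  exact IsLocalRing.maximalIdeal_comap _

theorem exists_supportDim_eq_natCast (M : Type u) [AddCommGroup M] [Module R M]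
    [Nontrivial M] : ∃ r : ℕ, Module.supportDim R M = r := by
  have h1 : Module.supportDim R M ≠ ⊥ := Module.supportDim_ne_bot_of_nontrivial R M
  have h2 : Module.supportDim R M ≠ ⊤ :=
    ((Module.supportDim_le_ringKrullDim R M).trans_lt ringKrullDim_lt_top).ne
  obtain ⟨d, hd⟩ := WithBot.ne_bot_iff_exists.1 h1
  obtain ⟨r, hr⟩ := ENat.ne_top_iff_exists.1 (show d ≠ ⊤ by rintro rfl; exact h2 hd.symm)
  exact ⟨r, by rw [← hd, ← hr]; rfl⟩

/-- Vanishing of `H^i_{I,J}(N)` for `i > dim N / J N`. -/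
theorem subsingleton_of_supportDim_lt {I J : Ideal R} (hIJ : (I ⊔ J).radical = maximalIdeal R)
    (N : ModuleCat.{u} R) [Module.Finite R N] (i : ℕ)
    (hi : Module.supportDim R (N ⧸ (J • ⊤ : Submodule R N)) < i) :
    Subsingleton ((localCohomologyPair I J i).obj N) := by
  have hJ : J ≤ maximalIdeal R := hIJ ▸ le_sup_right.trans Ideal.le_radical
  rcases subsingleton_or_nontrivial (N ⧸ (J • ⊤ : Submodule R N)) with hs | hs
  · have hN : Subsingleton N := by
      rw [Submodule.Quotient.subsingleton_iff] at hs
      rw [← Submodule.subsingleton_iff R, ← subsingleton_iff_bot_eq_top, eq_comm]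
      exact Submodule.eq_bot_of_le_smul_of_le_jacobson_bot J ⊤ Module.Finite.fg_top hs.ge
        (hJ.trans (maximalIdeal_le_jacobson _))
    cases i with
    | zero => exact (localCohomologyPairZeroEquiv I J N).toEquiv.subsingleton
    | succ n =>
      -- By Nakayama N = 0, so N is torsion even for the unit ideal, and modulo that ideal no
      -- generators are needed.
      refine subsingleton_of_list (A := ⊤) (fun x => ?_) [] ?_ ?_ (Nat.succ_pos n)
      · rw [Subsingleton.elim x 0, Ideal.torsionOf_zero]
        exact Ideal.le_radical
      · rw [top_sup_eq, sup_top_eq, Ideal.radical_top]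
        exact le_top
      · simp
  · obtain ⟨r, hr⟩ := exists_supportDim_eq_natCast (R := R) (N ⧸ (J • ⊤ : Submodule R N))
    have hri : r < i := by rw [hr] at hi; exact_mod_cast hi
    rw [Module.supportDim_eq_ringKrullDim_quotient_annihilator] at hr
    obtain ⟨l, hl, hrad⟩ := exists_list_radical_sup_eq _ (le_maximalIdeal (by
      rw [Ne, Module.annihilator_eq_top_iff]; exact not_subsingleton _)) hr
    have hlm : Ideal.ofList l ≤ maximalIdeal R :=
      hrad ▸ le_sup_left.trans Ideal.le_radical
    rw [Ideal.radical_sup, radical_annihilator_quotient] at hrad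
    have hle : maximalIdeal R ≤ (Ideal.ofList l ⊔ (Module.annihilator R N ⊔ J)).radical := by
      rw [Ideal.radical_sup, hrad]
    -- Modulo Ann N + J, both I and the parameters generate 𝔪 up to radical.
    refine subsingleton_of_list (isPowerTorsion_annihilator N) l ?_ ?_ (hl ▸ hri)
    · refine le_trans ?_ hle
      rw [← hIJ]
      exact le_sup_left.trans Ideal.le_radical
    · refine hlm.trans ?_
      rw [← hIJ]
      exact Ideal.radical_mono (sup_le_sup le_rfl le_sup_right)

end Parameters

/-! ### Artinian modules over Noetherian local rings -/

section Artinian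

open IsLocalRing

/-- M is a module over the Artinian ring R/𝔪^{k+1}. The exponent k + 1 keeps the ideal proper when k
= 0. -/
theorem isNoetherian_iff_isArtinian_of_pow_smul {R : Type u} [CommRing R] [IsNoetherianRing R]
    [IsLocalRing R] {M : Type u} [AddCommGroup M] [Module R M] {k : ℕ}
    (hk : ∀ r ∈ maximalIdeal R ^ k, ∀ x : M, r • x = 0) : IsNoetherian R M ↔ IsArtinian R M := by
  let a : Ideal R := maximalIdeal R ^ (k + 1)
  have htors : Module.IsTorsionBySet R M a := fun x r =>
    hk r (Ideal.pow_le_pow_right k.le_succ r.2) x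
  let _ := htors.module
  have : IsScalarTower R (R ⧸ a) M := htors.isScalarTower
  have : IsArtinianRing (R ⧸ a) :=
    quotient_artinian_of_mem_minimalPrimes_of_isLocalRing a
      ⟨⟨inferInstance, Ideal.pow_le_self k.succ_ne_zero⟩, fun q hq _ => hq.1.le_of_pow_le hq.2⟩
  have h1 : IsNoetherian R M ↔ IsNoetherian (R ⧸ a) M :=
    ⟨fun _ => isNoetherian_of_tower R inferInstance, fun h => by
      have : Module.Finite R M := Module.Finite.trans (R ⧸ a) M
      infer_instance⟩
  have h2 : IsArtinian R M ↔ IsArtinian (R ⧸ a) M :=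
    ⟨fun _ => isArtinian_of_tower R inferInstance, fun h =>
      isArtinian_of_surjective_algebraMap (R := R ⧸ a) Ideal.Quotient.mk_surjective⟩
  rw [h1, h2]
  exact IsSemiprimaryRing.isNoetherian_iff_isArtinian

/-- Melkersson's criterion for one element. -/
theorem isArtinian_of_isArtinian_torsionBy {R M : Type*} [CommRing R] [AddCommGroup M]
    [Module R M] {x : R} (hx : ∀ m : M, ∃ n : ℕ, x ^ n • m = 0)
    (h : IsArtinian R (Submodule.torsionBy R M x)) : IsArtinian R M := by
  rw [← monotone_stabilizes_iff_artinian] at h ⊢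
  intro f
  let A : ℕ → Submodule R M := fun j => OrderDual.ofDual (f j)
  have hA : ∀ i j, i ≤ j → A j ≤ A i := fun i j hij => f.monotone hij
  let T := Submodule.torsionBy R M x
  -- The submodules x^n A_j ∩ T of the x-torsion T decrease in both indices.
  let B : ℕ → ℕ → Submodule R T := fun n j =>
    ((A j).map (LinearMap.lsmul R M (x ^ n))).comap T.subtype
  have hB : ∀ n n' j j', n ≤ n' → j ≤ j' → B n' j' ≤ B n j := by
    rintro n n' j j' hn hj y ⟨z, hz, hzy⟩
    refine ⟨x ^ (n' - n) • z, (A j).smul_mem _ (hA j j' hj hz), ?_⟩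
    rw [← hzy, LinearMap.lsmul_apply, LinearMap.lsmul_apply, smul_smul, ← pow_add]
    congr 2
    omega
  obtain ⟨k₀, hk₀⟩ := h ⟨fun k => OrderDual.toDual (B k k), fun i j hij => hB _ _ _ _ hij hij⟩
  have hk₀' : ∀ n j, k₀ ≤ n → k₀ ≤ j → B n j = B k₀ k₀ := by
    intro n j hn hj
    refine le_antisymm (hB _ _ _ _ hn hj) ?_
    have h1 : B k₀ k₀ = B (max n j) (max n j) := hk₀ (max n j) (hn.trans (le_max_left _ _))
    rw [h1]
    exact hB _ _ _ _ (le_max_left _ _) (le_max_right _ _)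
  choose g hg using fun n => h ⟨fun k => OrderDual.toDual (B n k), fun i j hij =>
    hB _ _ _ _ le_rfl hij⟩
  -- Rows n ≥ k₀ all agree once j ≥ k₀, and the finitely many other rows stabilise from `g n` on, so
  -- one bound serves every row.
  let N := max k₀ ((Finset.range k₀).sup g)
  have hN : ∀ n j, N ≤ j → B n j = B n N := by
    intro n j hj
    by_cases hn : k₀ ≤ n
    · rw [hk₀' n j hn ((le_max_left _ _).trans hj), hk₀' n N hn (le_max_left _ _)]
    · have h1 : g n ≤ N := (Finset.le_sup (f := g) (Finset.mem_range.2 (not_le.1 hn))).trans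
        (le_max_right _ _)
      exact (hg n j (h1.trans hj)).symm.trans (hg n N h1)
  refine ⟨N, fun j hj => le_antisymm (α := Submodule R M) ?_ (hA N j hj)⟩
  suffices key : ∀ n, ∀ z ∈ A N, x ^ n • z = 0 → z ∈ A j by
    intro z hz
    obtain ⟨n, hn⟩ := hx z
    exact key n z hz hn
  intro n
  induction n with
  | zero =>
    intro z _ hz0
    rw [pow_zero, one_smul] at hz0
    exact hz0 ▸ (A j).zero_mem
  | succ n ih =>
    intro z hz hz0
    have hT : x ^ n • z ∈ T := by
      rw [Submodule.mem_torsionBy_iff, smul_smul, ← pow_succ']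
      exact hz0
    have h1 : (⟨x ^ n • z, hT⟩ : T) ∈ B n N := ⟨z, hz, rfl⟩
    rw [← hN n j hj] at h1
    obtain ⟨z', hz', hzz'⟩ := h1
    have h2 : z - z' ∈ A j := by
      refine ih _ ((A N).sub_mem hz (hA N j hj hz')) ?_
      rw [smul_sub, sub_eq_zero]
      exact hzz'.symm
    simpa using (A j).add_mem h2 hz'

section

variable {R M : Type*} [CommRing R] [AddCommGroup M] [Module R M]

/-- A homothety acts on a sum-irreducible Artinian submodule surjectively or nilpotently. -/
theorem map_eq_or_pow_smul_eq_zero [IsArtinian R M] {B : Submodule R M}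
    (hB : ∀ B₁ < B, ∀ B₂ < B, B ≠ B₁ ⊔ B₂) (r : R) :
    B.map (LinearMap.lsmul R M r) = B ∨ r ∈ B.annihilator.radical := by
  have hmap : ∀ n, B.map (LinearMap.lsmul R M (r ^ n)) ≤ B := by
    rintro n _ ⟨y, hy, rfl⟩
    exact B.smul_mem _ hy
  obtain ⟨n, hn⟩ := IsArtinian.monotone_stabilizes (R := R) (M := M)
    ⟨fun n => OrderDual.toDual (B.map (LinearMap.lsmul R M (r ^ n))), fun i j hij => by
      rintro _ ⟨y, hy, rfl⟩
      refine ⟨r ^ (j - i) • y, B.smul_mem _ hy, ?_⟩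
      rw [LinearMap.lsmul_apply, LinearMap.lsmul_apply, smul_smul, ← pow_add]
      congr 2
      omega⟩
  have hstab : B.map (LinearMap.lsmul R M (r ^ n)) =
      B.map (LinearMap.lsmul R M (r ^ (n + (n + 1)))) := hn _ (by omega)
  -- Fitting decomposition. With exponent n + 1 rather than n, the equality B₁ = B gives rB = B even
  -- when n = 0.
  let B₁ := B.map (LinearMap.lsmul R M (r ^ (n + 1)))
  let B₂ := B ⊓ LinearMap.ker (LinearMap.lsmul R M (r ^ n))
  have hsup : B = B₁ ⊔ B₂ := by
    refine le_antisymm (fun y hy => ?_) (sup_le (hmap _) inf_le_left)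
    have h1 : r ^ n • y ∈ B.map (LinearMap.lsmul R M (r ^ (n + (n + 1)))) :=
      hstab ▸ ⟨y, hy, rfl⟩
    obtain ⟨z, hz, hzy⟩ := h1
    have hB₁ : r ^ (n + 1) • z ∈ B₁ := ⟨z, hz, rfl⟩
    refine Submodule.mem_sup.2 ⟨r ^ (n + 1) • z, hB₁, y - r ^ (n + 1) • z,
      ⟨B.sub_mem hy (B.smul_mem _ hz), ?_⟩, add_sub_cancel _ _⟩
    rw [SetLike.mem_coe, LinearMap.mem_ker, map_sub, sub_eq_zero, LinearMap.lsmul_apply,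
      LinearMap.lsmul_apply, smul_smul, ← pow_add]
    exact hzy.symm
  by_cases h₁ : B₁ = B
  · left
    refine le_antisymm (by simpa using hmap 1) ?_
    conv_lhs => rw [← h₁]
    rintro _ ⟨y, hy, rfl⟩
    exact ⟨r ^ n • y, B.smul_mem _ hy, by
      rw [LinearMap.lsmul_apply, LinearMap.lsmul_apply, smul_smul, pow_succ']⟩
  · right
    by_cases h₂ : B₂ = B
    · refine ⟨n, Submodule.mem_annihilator.2 fun y hy => ?_⟩
      exact (h₂.ge hy).2
    · exact absurd hsup (hB B₁ (lt_of_le_of_ne (hmap _) h₁) B₂ (lt_of_le_of_ne inf_le_left h₂))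

end

/-- For an Artinian module `M` over a Noetherian local ring, multiplication by an element of the
maximal ideal outside finitely many primes has finitely generated cokernel. -/
theorem exists_finset_fg_sup_range {R : Type u} [CommRing R] [IsNoetherianRing R] [IsLocalRing R]
    (M : Type u) [AddCommGroup M] [Module R M] [IsArtinian R M] (B : Submodule R M) :
    ∃ Q : Finset (Ideal R), (∀ p ∈ Q, p.IsPrime ∧ p ≠ maximalIdeal R) ∧
      ∀ x : R, (∀ p ∈ Q, x ∉ p) →
        ∃ L : Submodule R M, L.FG ∧ B ≤ L ⊔ LinearMap.range (LinearMap.lsmul R M x) := by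
  classical
  induction B using WellFoundedLT.induction with
  | ind B ih =>
  by_cases hB : ∀ B₁ < B, ∀ B₂ < B, B ≠ B₁ ⊔ B₂
  · by_cases hbot : B = ⊥
    · exact ⟨∅, by simp, fun x _ => ⟨⊥, Submodule.fg_bot, by simp [hbot]⟩⟩
    -- If the radical of Ann B is 𝔪, then B has finite length and is itself the finitely generated
    -- part. Otherwise this radical is a prime, and elements outside it act surjectively on B.
    by_cases hp : B.annihilator.radical = maximalIdeal R
    · obtain ⟨k, hk⟩ := Ideal.exists_pow_le_of_le_radical_of_fg hp.ge (IsNoetherian.noetherian _)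
      refine ⟨∅, by simp, fun x _ => ⟨B, ?_, le_sup_left⟩⟩
      have : IsNoetherian R B := (isNoetherian_iff_isArtinian_of_pow_smul (k := k) fun r hr x =>
        Subtype.ext (Submodule.mem_annihilator.1 (hk hr) x x.2)).2 inferInstance
      exact Module.Finite.iff_fg.1 inferInstance
    · refine ⟨{B.annihilator.radical}, ?_, fun x hx => ⟨⊥, Submodule.fg_bot, ?_⟩⟩
      · simp only [Finset.mem_singleton, forall_eq]
        refine ⟨⟨?_, fun {a b} hab => ?_⟩, hp⟩
        · rwa [Ne, Ideal.radical_eq_top, Submodule.annihilator_eq_top_iff]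
        · rw [or_iff_not_imp_left]
          intro ha
          have haB := (map_eq_or_pow_smul_eq_zero hB a).resolve_right ha
          obtain ⟨n, hn⟩ := hab
          refine ⟨n, Submodule.mem_annihilator.2 fun y hy => ?_⟩
          have hpow : ∀ k : ℕ, ∀ y ∈ B, ∃ z ∈ B, a ^ k • z = y := by
            intro k
            induction k with
            | zero => exact fun y hy => ⟨y, hy, by simp⟩
            | succ k ihk =>
              intro y hy
              obtain ⟨z, hz, rfl⟩ := ihk y hy
              rw [← haB] at hz
              obtain ⟨w, hw, rfl⟩ := hz
              exact ⟨w, hw, by rw [LinearMap.lsmul_apply, pow_succ, mul_smul]⟩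
          obtain ⟨z, hz, rfl⟩ := hpow n y hy
          rw [smul_smul, ← mul_pow, mul_comm]
          exact Submodule.mem_annihilator.1 hn z hz
      · have hxB := (map_eq_or_pow_smul_eq_zero hB x).resolve_right (hx _ (by simp))
        rw [bot_sup_eq]
        conv_lhs => rw [← hxB]
        exact LinearMap.map_le_range
  · push Not at hB
    obtain ⟨B₁, hB₁, B₂, hB₂, rfl⟩ := hB
    obtain ⟨Q₁, hQ₁, h₁⟩ := ih B₁ hB₁
    obtain ⟨Q₂, hQ₂, h₂⟩ := ih B₂ hB₂
    refine ⟨Q₁ ∪ Q₂, fun p hp => (Finset.mem_union.1 hp).elim (hQ₁ p) (hQ₂ p), fun x hx => ?_⟩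
    obtain ⟨L₁, hL₁, hx₁⟩ := h₁ x fun p hp => hx p (Finset.mem_union_left _ hp)
    obtain ⟨L₂, hL₂, hx₂⟩ := h₂ x fun p hp => hx p (Finset.mem_union_right _ hp)
    refine ⟨L₁ ⊔ L₂, hL₁.sup hL₂, sup_le ?_ ?_⟩
    · exact hx₁.trans (sup_le_sup le_sup_left le_rfl)
    · exact hx₂.trans (sup_le_sup le_sup_right le_rfl)

end Artinian

/-! ### The long exact sequence for linear maps -/

section ModuleSequence

variable {R : Type u} [CommRing R] (I J : Ideal R)

/-- The map induced by a linear map on local cohomology with respect to a pair of ideals. -/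
noncomputable def cohomologyMap (i : ℕ) {N N' : Type u} [AddCommGroup N] [Module R N]
    [AddCommGroup N'] [Module R N'] (f : N →ₗ[R] N') :
    (localCohomologyPair I J i).obj (ModuleCat.of R N) →ₗ[R]
      (localCohomologyPair I J i).obj (ModuleCat.of R N') :=
  ((localCohomologyPair I J i).map (ModuleCat.ofHom f)).hom

theorem cohomologyMap_lsmul (i : ℕ) (N : Type u) [AddCommGroup N] [Module R N] (r : R) :
    cohomologyMap I J i (LinearMap.lsmul R N r) = LinearMap.lsmul R _ r :=
   congrArg ModuleCat.Hom.hom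
    (rightDerived_map_smul (torsionFunctor I J) i (ModuleCat.of R N) r)

variable {N₁ N₂ N₃ : Type u} [AddCommGroup N₁] [Module R N₁] [AddCommGroup N₂] [Module R N₂]
  [AddCommGroup N₃] [Module R N₃] {f : N₁ →ₗ[R] N₂} {g : N₂ →ₗ[R] N₃}

theorem exact_cohomologyMap (hf : Function.Injective f) (hfg : Function.Exact f g)
    (hg : Function.Surjective g) (i : ℕ) :
    Function.Exact (cohomologyMap I J i f) (cohomologyMap I J i g) := by
  let S := ShortComplex.mk (ModuleCat.ofHom f) (ModuleCat.ofHom g)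
    (ModuleCat.hom_ext hfg.linearMap_comp_eq_zero)
  have hS : S.ShortExact := ModuleCat.shortComplex_shortExact S hfg hf hg
  obtain ⟨w, h⟩ := rightDerived_exact₂ (torsionFunctor I J) hS i
  exact (ShortComplex.ShortExact.moduleCat_exact_iff_function_exact _).1 h

theorem exists_connectingMap (hf : Function.Injective f) (hfg : Function.Exact f g)
    (hg : Function.Surjective g) (i : ℕ) :
    ∃ δ : (localCohomologyPair I J i).obj (ModuleCat.of R N₃) →ₗ[R]
        (localCohomologyPair I J (i + 1)).obj (ModuleCat.of R N₁),
      Function.Exact (cohomologyMap I J i g) δ ∧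
        Function.Exact δ (cohomologyMap I J (i + 1) f) := by
  let S := ShortComplex.mk (ModuleCat.ofHom f) (ModuleCat.ofHom g)
    (ModuleCat.hom_ext hfg.linearMap_comp_eq_zero)
  have hS : S.ShortExact := ModuleCat.shortComplex_shortExact S hfg hf hg
  obtain ⟨δ, w₁, w₂, h₁, h₂⟩ := exists_connecting (torsionFunctor I J) hS i
  exact ⟨δ.hom, (ShortComplex.ShortExact.moduleCat_exact_iff_function_exact _).1 h₁,
    (ShortComplex.ShortExact.moduleCat_exact_iff_function_exact _).1 h₂⟩

end ModuleSequence

/-! ### Power torsion modules and regular elements -/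

section Nonvanishing

open IsLocalRing

variable {R : Type u} [CommRing R]

variable [IsNoetherianRing R]

theorem exists_pow_smul_eq_zero {A : Ideal R} {N : Type u} [AddCommGroup N] [Module R N]
    [Module.Finite R N] (h : IsPowerTorsion A N) :
    ∃ k : ℕ, ∀ r ∈ A ^ k, ∀ x : N, r • x = 0 := by
  obtain ⟨a, ha, hax⟩ := exists_ideal_smul_eq_zero (I := A) (J := ⊥) (L := (⊤ : Submodule R N))
    Module.Finite.fg_top fun x _ => mem_torsionPart_bot_iff.2 (h x)
  rw [sup_bot_eq] at ha
  obtain ⟨k, hk⟩ := Ideal.exists_pow_le_of_le_radical_of_fg ha (IsNoetherian.noetherian _)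
  exact ⟨k, fun r hr x => hax r (hk hr) x trivial⟩

theorem torsionPart_bot_quotient_torsionPart (A : Ideal R) (N : Type u) [AddCommGroup N]
    [Module R N] : torsionPart A ⊥ (N ⧸ torsionPart A ⊥ N) = ⊥ := by
  rw [eq_bot_iff]
  intro y hy
  obtain ⟨y, rfl⟩ := Submodule.mkQ_surjective _ y
  rw [mem_torsionPart_bot_iff] at hy
  rw [Submodule.mem_bot, Submodule.mkQ_apply, Submodule.Quotient.mk_eq_zero,
    mem_torsionPart_bot_iff]
  intro r hr
  obtain ⟨n, hn⟩ := hy hr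
  rw [Ideal.mem_torsionOf_iff, ← map_smul, Submodule.mkQ_apply, Submodule.Quotient.mk_eq_zero,
    mem_torsionPart_bot_iff] at hn
  obtain ⟨m, hm⟩ := hn hr
  refine ⟨m + n, ?_⟩
  rw [Ideal.mem_torsionOf_iff] at hm ⊢
  rw [pow_add, mul_smul, hm]

variable [IsLocalRing R] {I J : Ideal R}

/-- When J lies in the radical of Ann x, adding J to Ann x does not change that radical, and
containing I amounts to containing I + J, that is, 𝔪. -/
theorem torsionPart_eq_of_isPowerTorsion (hIJ : (I ⊔ J).radical = maximalIdeal R) {N : Type u}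
    [AddCommGroup N] [Module R N] (hN : IsPowerTorsion J N) :
    torsionPart I J N = torsionPart (maximalIdeal R) ⊥ N := by
  ext x
  rw [mem_torsionPart_iff, mem_torsionPart_bot_iff, ← hIJ,
    (Ideal.radical_isRadical _).radical_le_iff, sup_le_iff, and_iff_left (hN x),
    ← Ideal.radical_idem (Ideal.torsionOf R N x), Ideal.radical_sup, Ideal.radical_idem,
    sup_eq_left.2 ((Ideal.radical_isRadical _).radical_le_iff.2 (hN x)), Ideal.radical_idem]

theorem isPowerTorsion_localCohomologyPair (hIJ : (I ⊔ J).radical = maximalIdeal R) {N : Type u}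
    [AddCommGroup N] [Module R N] (hN : IsPowerTorsion J N) (i : ℕ) :
    IsPowerTorsion (maximalIdeal R) ((localCohomologyPair I J i).obj (ModuleCat.of R N)) := by
  intro z r hr
  obtain ⟨P, hP⟩ := exists_torsion_injectiveResolution (ModuleCat.of R N) hN
  obtain ⟨_, ⟨n, rfl⟩, hn⟩ := exists_smul_eq_zero_of_forall P i (Set.range (r ^ ·)) (fun x hx => by
    rw [torsionPart_eq_of_isPowerTorsion hIJ (hP i), mem_torsionPart_bot_iff] at hx
    obtain ⟨n, hn⟩ := hx hr
    exact ⟨_, ⟨n, rfl⟩, hn⟩) z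
  exact ⟨n, hn⟩

theorem subsingleton_of_isPowerTorsion (hIJ : (I ⊔ J).radical = maximalIdeal R) {N : Type u}
    [AddCommGroup N] [Module R N] (hN : IsPowerTorsion (maximalIdeal R) N) (i : ℕ) :
    Subsingleton ((localCohomologyPair I J (i + 1)).obj (ModuleCat.of R N)) := by
  refine subsingleton_of_list (N := ModuleCat.of R N) hN [] ?_ ?_ (Nat.succ_pos i)
  · have h : I ≤ maximalIdeal R := hIJ ▸ le_sup_left.trans Ideal.le_radical
    exact h.trans (le_trans (le_trans le_sup_left le_sup_right) Ideal.le_radical)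
  · simp

/-- Passing to the quotient by the `𝔪`-torsion part does not change local cohomology in positive
degrees. -/
theorem bijective_cohomologyMap_mkQ (hIJ : (I ⊔ J).radical = maximalIdeal R) (N : Type u)
    [AddCommGroup N] [Module R N] (i : ℕ) :
    Function.Bijective
      (cohomologyMap I J (i + 1) (torsionPart (maximalIdeal R) ⊥ N).mkQ) := by
  let L := torsionPart (maximalIdeal R) ⊥ N
  have hL (i) : Subsingleton ((localCohomologyPair I J (i + 1)).obj (ModuleCat.of R L)) :=
    subsingleton_of_isPowerTorsion hIJ (isPowerTorsion_torsionPart N) i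
  have hex : Function.Exact L.subtype L.mkQ := LinearMap.exact_subtype_mkQ L
  constructor
  · rw [injective_iff_map_eq_zero]
    intro z hz
    obtain ⟨w, rfl⟩ := (exact_cohomologyMap I J L.subtype_injective hex L.mkQ_surjective (i + 1)
      z).1 hz
    rw [Subsingleton.elim w 0, map_zero]
  · intro z
    obtain ⟨δ, h, -⟩ := exists_connectingMap I J L.subtype_injective hex L.mkQ_surjective (i + 1)
    exact (h z).1 (Subsingleton.elim _ _)

/-- Prime avoidance: without 𝔪-torsion, 𝔪 is not associated to N, so the associated primes and those
of Q are avoided together. -/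
theorem exists_isSMulRegular {N : Type u} [AddCommGroup N] [Module R N] [Module.Finite R N]
    (hN : torsionPart (maximalIdeal R) ⊥ N = ⊥) (Q : Finset (Ideal R))
    (hQ : ∀ p ∈ Q, p.IsPrime ∧ p ≠ maximalIdeal R) :
    ∃ x ∈ maximalIdeal R, IsSMulRegular N x ∧ ∀ p ∈ Q, x ∉ p := by
  classical
  let T : Finset (Ideal R) := (associatedPrimes.finite R N).toFinset ∪ Q
  have hT : ∀ p ∈ T, p.IsPrime ∧ p ≠ maximalIdeal R := by
    intro p hp
    rcases Finset.mem_union.1 hp with hp | hp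
    · rw [Set.Finite.mem_toFinset] at hp
      refine ⟨hp.isPrime, ?_⟩
      rintro rfl
      obtain ⟨-, y, hy⟩ := isAssociatedPrime_iff.1 hp
      have hy' : y ∈ torsionPart (maximalIdeal R) ⊥ N := by
        rw [mem_torsionPart_bot_iff]
        refine le_trans (fun r hr => ?_) Ideal.le_radical
        rw [hy, Submodule.mem_colon_singleton] at hr
        exact hr
      rw [hN, Submodule.mem_bot] at hy'
      refine (maximalIdeal.isMaximal R).ne_top ?_
      rw [hy, hy']
      simp
    · exact hQ p hp
  have hx : ¬ ((maximalIdeal R : Set R) ⊆ ⋃ p ∈ (T : Set (Ideal R)), p) := by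
    intro h
    obtain ⟨p, hp, hle⟩ := (Ideal.subset_union_prime (f := id) ⊥ ⊥
      (fun p hp _ _ => (hT p hp).1)).1 h
    exact (hT p hp).2 (((le_maximalIdeal (hT p hp).1.ne_top).antisymm hle))
  obtain ⟨x, hxm, hxT⟩ := Set.not_subset.1 hx
  rw [Set.mem_iUnion₂] at hxT
  push Not at hxT
  refine ⟨x, hxm, ?_, fun p hp => hxT p (Finset.mem_union_right _ hp)⟩
  by_contra hreg
  have h : x ∈ ⋃ p ∈ associatedPrimes R N, (p : Set R) := by
    rw [biUnion_associatedPrimes_eq_compl_regular R N]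
    exact hreg
  obtain ⟨p, hp, hxp⟩ := Set.mem_iUnion₂.1 h
  exact hxT p (Finset.mem_union_left _ ((Set.Finite.mem_toFinset _).2 hp)) hxp

end Nonvanishing

/-! ### Supports and dimension modulo 𝔪-torsion -/

section Dimension

theorem exact_lsmul_mkQ {R : Type*} [CommRing R] (N : Type*) [AddCommGroup N] [Module R N] (x : R) :
    Function.Exact (LinearMap.lsmul R N x)
      (LinearMap.range (LinearMap.lsmul R N x)).mkQ :=
  LinearMap.exact_iff.2 (Submodule.ker_mkQ _)

open IsLocalRing

variable {R : Type u} [CommRing R] [IsLocalRing R]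

theorem support_subset_of_isPowerTorsion {N : Type u} [AddCommGroup N] [Module R N]
    (hN : IsPowerTorsion (maximalIdeal R) N) : Module.support R N ⊆ {closedPoint R} := by
  intro p hp
  obtain ⟨y, hy⟩ := Module.mem_support_iff'.1 hp
  refine PrimeSpectrum.ext ((le_maximalIdeal p.2.ne_top).antisymm fun r hr => ?_)
  obtain ⟨n, hn⟩ := hN y hr
  by_contra hrp
  exact hy (r ^ n) (fun h => hrp (p.2.mem_of_pow_mem n h)) hn

theorem isPowerTorsion_of_supportDim_eq_zero {N : Type u} [AddCommGroup N] [Module R N]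
    [Module.Finite R N] (hN : Module.supportDim R N = 0) :
    IsPowerTorsion (maximalIdeal R) N := by
  have h := support_of_supportDim_eq_zero R N hN
  rw [Module.support_eq_zeroLocus, PrimeSpectrum.zeroLocus_eq_iff] at h
  intro x
  refine Ideal.le_radical.trans (h.ge.trans (Ideal.radical_mono fun r hr => ?_))
  exact (Ideal.mem_torsionOf_iff x r).2 (Module.mem_annihilator.1 hr x)

/-- L contributes at most the closed point to the support, and that point already lies in the
support of N/L, which is nonzero because dim N > 0. -/
theorem supportDim_quotient_eq_of_isPowerTorsion {N : Type u} [AddCommGroup N] [Module R N]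
    {L : Submodule R N} (hL : IsPowerTorsion (maximalIdeal R) L)
    (hN : 0 < Module.supportDim R N) :
    Module.supportDim R (N ⧸ L) = Module.supportDim R N := by
  have hsupp := Module.support_of_exact (LinearMap.exact_subtype_mkQ L) L.subtype_injective
    L.mkQ_surjective
  have hL' := support_subset_of_isPowerTorsion hL
  have hne : Nontrivial (N ⧸ L) := by
    by_contra h
    rw [not_nontrivial_iff_subsingleton] at h
    rw [Module.support_eq_empty (M := N ⧸ L), Set.union_empty] at hsupp
    have : Subsingleton (Module.support R N) :=
      Set.subsingleton_coe _ |>.2 (Set.subsingleton_singleton.anti (hsupp.trans_subset hL'))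
    exact absurd hN (not_lt.2 Order.krullDim_nonpos_of_subsingleton)
  have h : Module.support R (N ⧸ L) = Module.support R N := by
    rw [hsupp, eq_comm, Set.union_eq_right]
    intro p hp
    rw [Set.mem_singleton_iff.1 (hL' hp)]
    exact IsLocalRing.closedPoint_mem_support R _
  rw [Module.supportDim, Module.supportDim, h]

end Dimension

/-! ### Artinianness and nonvanishing in top degree -/

section TopDegree

open IsLocalRing

variable {R : Type u} [CommRing R] [IsNoetherianRing R] [IsLocalRing R] {I J : Ideal R}

theorem supportDim_quotient_range_lsmul_add_one {N : Type u} [AddCommGroup N] [Module R N]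
    [Module.Finite R N] {x : R} (hx : x ∈ maximalIdeal R) (hreg : IsSMulRegular N x) :
    Module.supportDim R (N ⧸ LinearMap.range (LinearMap.lsmul R N x)) + 1 =
      Module.supportDim R N := by
  rw [← Module.supportDim_quotSMulTop_succ_eq_supportDim hreg hx]
  congr 1
  refine Module.supportDim_eq_of_equiv (Submodule.quotEquivOfEq _ _ ?_)
  rw [LinearMap.range_eq_map]
  rfl

theorem supportDim_quotient_range_lsmul {N : Type u} [AddCommGroup N] [Module R N]
    [Module.Finite R N] {x : R} (hx : x ∈ maximalIdeal R) (hreg : IsSMulRegular N x) {r : ℕ}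
    (hr : Module.supportDim R N = ((r + 1 : ℕ) : WithBot ℕ∞)) :
    Module.supportDim R (N ⧸ LinearMap.range (LinearMap.lsmul R N x)) = r := by
  have h := supportDim_quotient_range_lsmul_add_one hx hreg
  rw [hr] at h
  rcases subsingleton_or_nontrivial (N ⧸ LinearMap.range (LinearMap.lsmul R N x)) with hs | hs
  · rw [Module.supportDim_eq_bot_of_subsingleton] at h
    exact absurd h.symm (WithBot.coe_ne_bot (a := ((r + 1 : ℕ) : ℕ∞)))
  · obtain ⟨s, hs⟩ := exists_supportDim_eq_natCast (R := R)
      (N ⧸ LinearMap.range (LinearMap.lsmul R N x))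
    rw [hs] at h ⊢
    have h' : s + 1 = r + 1 := by exact_mod_cast h
    rw [Nat.succ_injective h']

/-- If `J` acts locally nilpotently on `N`, then the modules `H^i_{I,J}(N)` are Artinian. -/
theorem isArtinian_localCohomologyPair (hIJ : (I ⊔ J).radical = maximalIdeal R) (i : ℕ) :
    ∀ (N : Type u) [AddCommGroup N] [Module R N] [Module.Finite R N], IsPowerTorsion J N →
      IsArtinian R ((localCohomologyPair I J i).obj (ModuleCat.of R N)) := by
  induction i with
  | zero =>
    intro N _ _ _ hN
    have h : IsPowerTorsion (maximalIdeal R) (torsionPart I J N) := by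
      rw [torsionPart_eq_of_isPowerTorsion hIJ hN]
      exact isPowerTorsion_torsionPart N
    obtain ⟨k, hk⟩ := exists_pow_smul_eq_zero h
    have := (isNoetherian_iff_isArtinian_of_pow_smul hk).1 inferInstance
    exact isArtinian_of_linearEquiv (localCohomologyPairZeroEquiv I J (ModuleCat.of R N)).symm
  | succ i ih =>
    intro N _ _ _ hN
    let N' := N ⧸ torsionPart (maximalIdeal R) ⊥ N
    have hN' : IsPowerTorsion J N' := hN.of_map _ (Submodule.mkQ_surjective _)
    suffices IsArtinian R ((localCohomologyPair I J (i + 1)).obj (ModuleCat.of R N')) from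
      isArtinian_of_injective _ (bijective_cohomologyMap_mkQ hIJ N i).1
    obtain ⟨x, hx, hreg, -⟩ := exists_isSMulRegular
      (torsionPart_bot_quotient_torsionPart (maximalIdeal R) N) ∅ (by simp)
    -- Melkersson's criterion: the x-torsion of H^{i+1}(N') is the image of H^i(N'/xN'), Artinian by
    -- induction.
    refine isArtinian_of_isArtinian_torsionBy (x := x)
      (fun z => isPowerTorsion_localCohomologyPair hIJ hN' (i + 1) z hx) ?_
    obtain ⟨δ, -, hδ⟩ := exists_connectingMap I J (f := LinearMap.lsmul R N' x) hreg
      (exact_lsmul_mkQ N' x) (Submodule.mkQ_surjective _) i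
    have := ih _ (hN'.of_map _ (Submodule.mkQ_surjective
      (LinearMap.range (LinearMap.lsmul R N' x))))
    have h : Submodule.torsionBy R _ x = LinearMap.range δ := by
      rw [← LinearMap.exact_iff.1 hδ, cohomologyMap_lsmul]
      rfl
    rw [h]
    infer_instance

/-- If `J` acts locally nilpotently on `N` and `dim N = r + 1`, then `H^{r+1}_{I,J}(N)` is not
finitely generated. -/
theorem not_finite_localCohomologyPair (hIJ : (I ⊔ J).radical = maximalIdeal R) (r : ℕ) :
    ∀ (N : Type u) [AddCommGroup N] [Module R N] [Module.Finite R N], IsPowerTorsion J N →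
      Module.supportDim R N = ((r + 1 : ℕ) : WithBot ℕ∞) →
      ¬ Module.Finite R ((localCohomologyPair I J (r + 1)).obj (ModuleCat.of R N)) := by
  induction r with
  | zero =>
    intro N₀ _ _ _ hN₀ hdim₀ hfin₀
    let N := N₀ ⧸ torsionPart (maximalIdeal R) ⊥ N₀
    have hN : IsPowerTorsion J N := hN₀.of_map _ (Submodule.mkQ_surjective _)
    have hdim : Module.supportDim R N = ((0 + 1 : ℕ) : WithBot ℕ∞) := by
      rw [← hdim₀]
      refine supportDim_quotient_eq_of_isPowerTorsion (isPowerTorsion_torsionPart _) ?_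
      rw [hdim₀]
      exact_mod_cast Nat.succ_pos _
    have hfin := Module.Finite.of_surjective (R := R) _ (bijective_cohomologyMap_mkQ hIJ N₀ 0).2
    -- If H^1(N) were finitely generated, some 𝔪^k would kill it. As N/x^{k+1}N embeds in H^1(N),
    -- this gives x^k N ⊆ x^{k+1}N, so N = xN, contradicting dim N/xN = 0.
    obtain ⟨k, hk⟩ := exists_pow_smul_eq_zero (isPowerTorsion_localCohomologyPair hIJ hN 1)
    have hΓ : torsionPart (maximalIdeal R) ⊥ N = ⊥ := torsionPart_bot_quotient_torsionPart _ N₀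
    obtain ⟨x, hx, hreg, -⟩ := exists_isSMulRegular hΓ ∅ (by simp)
    have hreg' : IsSMulRegular N (x ^ (k + 1)) := hreg.pow (k + 1)
    let C := N ⧸ LinearMap.range (LinearMap.lsmul R N (x ^ (k + 1)))
    have hC : IsPowerTorsion (maximalIdeal R) C := isPowerTorsion_of_supportDim_eq_zero
      (supportDim_quotient_range_lsmul (Ideal.pow_mem_of_mem _ hx _ k.succ_pos) hreg' hdim)
    have hJC : IsPowerTorsion J C := hN.of_map _ (Submodule.mkQ_surjective _)
    have h₀ : Subsingleton ((localCohomologyPair I J 0).obj (ModuleCat.of R N)) := by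
      have : Subsingleton (torsionPart I J N) := by
        rw [torsionPart_eq_of_isPowerTorsion hIJ hN, hΓ]
        infer_instance
      exact (localCohomologyPairZeroEquiv I J (ModuleCat.of R N)).toEquiv.subsingleton
    obtain ⟨δ, hδ, -⟩ := exists_connectingMap I J (f := LinearMap.lsmul R N (x ^ (k + 1))) hreg'
      (exact_lsmul_mkQ N (x ^ (k + 1))) (Submodule.mkQ_surjective _) 0
    have hδinj : Function.Injective δ := by
      rw [injective_iff_map_eq_zero]
      intro z hz
      obtain ⟨w, rfl⟩ := (hδ z).1 hz
      rw [Subsingleton.elim w 0, map_zero]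
    have hkill : ∀ y : C, x ^ k • y = 0 := by
      intro y
      have hy : y ∈ torsionPart I J C := by
        rw [torsionPart_eq_of_isPowerTorsion hIJ hJC, mem_torsionPart_bot_iff]
        exact hC y
      let e := localCohomologyPairZeroEquiv I J (ModuleCat.of R C)
      have h : x ^ k • e.symm ⟨y, hy⟩ = 0 :=
        hδinj (by rw [map_smul, map_zero]; exact hk _ (Ideal.pow_mem_pow hx k) _)
      have h' : x ^ k • (⟨y, hy⟩ : torsionPart I J C) = 0 := by
        rw [← e.apply_symm_apply ⟨y, hy⟩, ← map_smul, h, map_zero]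
      exact congrArg Subtype.val h'
    have htop : LinearMap.range (LinearMap.lsmul R N x) = ⊤ := by
      refine eq_top_iff.2 fun y _ => ?_
      have h : Submodule.mkQ _ (x ^ k • y) = (0 : C) := by rw [map_smul]; exact hkill _
      rw [Submodule.mkQ_apply, Submodule.Quotient.mk_eq_zero] at h
      obtain ⟨z, hz⟩ := h
      refine ⟨z, hreg.pow k ?_⟩
      rw [LinearMap.lsmul_apply] at hz ⊢
      exact (smul_smul _ _ _).trans ((pow_succ x k).symm ▸ hz)
    have h := supportDim_quotient_range_lsmul hx hreg hdim
    rw [htop, Module.supportDim_eq_bot_of_subsingleton] at h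
    exact WithBot.bot_ne_coe (a := ((0 : ℕ) : ℕ∞)) h
  | succ r ih =>
    intro N₀ _ _ _ hN₀ hdim₀ hfin₀
    let N := N₀ ⧸ torsionPart (maximalIdeal R) ⊥ N₀
    have hN : IsPowerTorsion J N := hN₀.of_map _ (Submodule.mkQ_surjective _)
    have hdim : Module.supportDim R N = ((r + 1 + 1 : ℕ) : WithBot ℕ∞) := by
      rw [← hdim₀]
      refine supportDim_quotient_eq_of_isPowerTorsion (isPowerTorsion_torsionPart _) ?_
      rw [hdim₀]
      exact_mod_cast Nat.succ_pos _
    have hfin := Module.Finite.of_surjective (R := R) _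
      (bijective_cohomologyMap_mkQ hIJ N₀ (r + 1)).2
    have hart := isArtinian_localCohomologyPair hIJ (r + 1) N hN
    -- For x outside Q, H^{r+1}(N) is L + xH^{r+1}(N) with L finitely generated, so its image in
    -- H^{r+1}(C) is finitely generated. If H^{r+2}(N) were too, so would be H^{r+1}(C), against
    -- induction.
    obtain ⟨Q, hQ, hfg⟩ := exists_finset_fg_sup_range (R := R)
      ((localCohomologyPair I J (r + 1)).obj (ModuleCat.of R N)) ⊤
    obtain ⟨x, hx, hreg, hxQ⟩ := exists_isSMulRegular
      (torsionPart_bot_quotient_torsionPart (maximalIdeal R) N₀) Q hQ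
    let C := N ⧸ LinearMap.range (LinearMap.lsmul R N x)
    have hC : Module.supportDim R C = ((r + 1 : ℕ) : WithBot ℕ∞) :=
      supportDim_quotient_range_lsmul hx hreg hdim
    refine ih C (hN.of_map _ (Submodule.mkQ_surjective _)) hC ?_
    have hex := exact_cohomologyMap I J (f := LinearMap.lsmul R N x) hreg
      (exact_lsmul_mkQ N x) (Submodule.mkQ_surjective _) (r + 1)
    rw [cohomologyMap_lsmul] at hex
    obtain ⟨δ, hδ, -⟩ := exists_connectingMap I J (f := LinearMap.lsmul R N x) hreg
      (exact_lsmul_mkQ N x) (Submodule.mkQ_surjective _) (r + 1)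
    obtain ⟨L, hL, hLx⟩ := hfg x hxQ
    let φ := cohomologyMap I J (r + 1) (LinearMap.range (LinearMap.lsmul R N x)).mkQ
    have hφ : LinearMap.range φ = L.map φ := by
      refine le_antisymm ?_ LinearMap.map_le_range
      rw [LinearMap.range_eq_map φ]
      refine (Submodule.map_mono hLx).trans ?_
      rw [Submodule.map_sup, ← LinearMap.exact_iff.1 hex]
      exact (sup_eq_left.2 (Submodule.map_le_iff_le_comap.2 fun y hy =>
        (Submodule.mem_comap.2 (by rw [LinearMap.mem_ker.1 hy]; exact Submodule.zero_mem _)))).le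
    have h₁ : IsNoetherian R (LinearMap.range φ) := by
      have : Module.Finite R (LinearMap.range φ) := by
        rw [hφ]
        exact Module.Finite.iff_fg.2 (hL.map φ)
      infer_instance
    have h₂ : IsNoetherian R ((localCohomologyPair I J (r + 1)).obj (ModuleCat.of R C)) :=
      isNoetherian_of_range_eq_ker (LinearMap.range φ).subtype δ
        ((Submodule.range_subtype _).trans (LinearMap.exact_iff.1 hδ).symm)
    infer_instance

/-- H^r(M) surjects onto H^r(M/JM), where J acts as zero. Failure of finite generation settles r >
0; for r = 0 the quotient is nonzero and entirely torsion. -/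
theorem nontrivial_localCohomologyPair (hIJ : (I ⊔ J).radical = maximalIdeal R)
    (M : Type u) [AddCommGroup M] [Module R M] [Module.Finite R M] {r : ℕ}
    (hr : Module.supportDim R (M ⧸ (J • ⊤ : Submodule R M)) = r) :
    Nontrivial ((localCohomologyPair I J r).obj (ModuleCat.of R M)) := by
  let K : Submodule R M := J • ⊤
  have hJ : IsPowerTorsion J (M ⧸ K) := by
    intro y
    refine le_trans (fun a ha => ?_) Ideal.le_radical
    obtain ⟨y, rfl⟩ := K.mkQ_surjective y
    rw [Ideal.mem_torsionOf_iff, ← map_smul, Submodule.mkQ_apply, Submodule.Quotient.mk_eq_zero]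
    exact Submodule.smul_mem_smul ha trivial
  have hsurj : Function.Surjective (cohomologyMap I J r K.mkQ) := by
    have hK : Subsingleton ((localCohomologyPair I J (r + 1)).obj (ModuleCat.of R K)) := by
      refine subsingleton_of_supportDim_lt hIJ (ModuleCat.of R K) (r + 1) ?_
      have h : Module.supportDim R (K ⧸ (J • ⊤ : Submodule R K)) ≤ r := by
        have hsub : Module.support R (K ⧸ (J • ⊤ : Submodule R K)) ⊆ Module.support R (M ⧸ K) := by
          rw [Module.support_quotient, Module.support_quotient]
          exact Set.inter_subset_inter_left _
            (Module.support_subset_of_injective K.subtype K.subtype_injective)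
        rw [← hr]
        exact Order.krullDim_le_of_strictMono (fun a => ⟨a.1, hsub a.2⟩) fun {_ _} h => h
      refine h.trans_lt ?_
      exact_mod_cast Nat.lt_succ_self r
    obtain ⟨δ, hδ, -⟩ := exists_connectingMap I J K.subtype_injective
      (LinearMap.exact_subtype_mkQ K) K.mkQ_surjective r
    exact fun z => (hδ z).1 (Subsingleton.elim _ _)
  suffices Nontrivial ((localCohomologyPair I J r).obj (ModuleCat.of R (M ⧸ K))) from
    hsurj.nontrivial
  cases r with
  | zero =>
    have hm : IsPowerTorsion (maximalIdeal R) (M ⧸ K) := isPowerTorsion_of_supportDim_eq_zero hr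
    have htop : torsionPart I J (M ⧸ K) = ⊤ := by
      rw [torsionPart_eq_of_isPowerTorsion hIJ hJ]
      exact eq_top_iff.2 fun y _ => mem_torsionPart_bot_iff.2 (hm y)
    have : Nontrivial (M ⧸ K) := by
      rw [← Module.supportDim_ne_bot_iff_nontrivial R, hr]
      exact WithBot.coe_ne_bot (a := ((0 : ℕ) : ℕ∞))
    have : Nontrivial (torsionPart I J (M ⧸ K)) := by
      rw [htop]
      exact Submodule.topEquiv.toEquiv.nontrivial
    exact (localCohomologyPairZeroEquiv I J (ModuleCat.of R (M ⧸ K))).toEquiv.nontrivial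
  | succ r =>
    by_contra h
    rw [not_nontrivial_iff_subsingleton] at h
    exact not_finite_localCohomologyPair hIJ r (M ⧸ K) hJ hr inferInstance

end TopDegree

end PairLocalCohomology

theorem theorem4p5 {R : Type u} [CommRing R] [IsNoetherianRing R] [IsLocalRing R]
    (I J : Ideal R) (hprimary : (I ⊔ J).IsPrimary)
    (hradical : (I ⊔ J).radical = IsLocalRing.maximalIdeal R)
    (M : Type u) [AddCommGroup M] [Module R M] [Module.Finite R M] :
    sSup {d : WithBot ℕ∞ | ∃ i : ℕ, d = (i : WithBot ℕ∞) ∧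
        Nontrivial ((PairLocalCohomology.localCohomologyPair I J i).obj (ModuleCat.of R M))} =
      Module.supportDim R (M ⧸ (J • ⊤ : Submodule R M)) := by
  refine le_antisymm (sSup_le ?_) ?_
  · rintro _ ⟨i, rfl, hi⟩
    refine le_of_not_gt fun hlt => ?_
    have := PairLocalCohomology.subsingleton_of_supportDim_lt hradical (ModuleCat.of R M) i hlt
    exact not_subsingleton _ this
  · rcases subsingleton_or_nontrivial (M ⧸ (J • ⊤ : Submodule R M)) with hs | hs
    · rw [Module.supportDim_eq_bot_of_subsingleton]
      exact bot_le
    · obtain ⟨r, hr⟩ := PairLocalCohomology.exists_supportDim_eq_natCast (R := R)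
        (M ⧸ (J • ⊤ : Submodule R M))
      exact le_sSup ⟨r, hr, PairLocalCohomology.nontrivial_localCohomologyPair hradical M hr⟩
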